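/- Let $d\in\mathbb N$ and let $K\in C^1(\mathbb R^d\times\mathbb R^d;\mathbb R^d)$ satisfy, for some constant $L\ge 0$, $$ \text{(HK1)}\quad K(z,z')=-K(z',z),\qquad \text{(HK2)}\quad |\nabla_zK(z,z')|\le L\ \text{ and }\ |\nabla_{z'}K(z,z')|\le L,\qquad z,z'\in\mathbb R^d, $$ where $|\cdot|$ denotes the Euclidean norm on vectors and the operator norm on matrices. Let $f^{in}$ be a probability density on $\mathbb R^d$ with $\int_{\mathbb R^d}|z|f^{in}(z)\,dz<\infty$. A *weak solution* of the Cauchy problem for the mean-field PDE $$ \partial_tf+\operatorname{div}_z(f\,\mathcal Kf)=0,\qquad f|_{t=0}=f^{in},\qquad \mathcal Kf(t,z):=\int_{\mathbb R^d}K(z,z')f(t,z')\,dz', $$ in $C(\mathbb R;L^1(\mathbb R^d))$ is a continuous map $t\mapsto f(t,\cdot)\in L^1(\mathbb R^d)$ with $f(0,\cdot)=f^{in}$ and $\int_{\mathbb R^d}|z||f(t,z)|\,dz<\infty$ for each $t\in\mathbb R$ such that, for each bounded $\phi\in C^1(\mathbb R^d)$ with bounded first-order partial derivatives, the function $t\mapsto\int\phi(z)f(t,z)\,dz$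 is differentiable on $\mathbb R$ with $$ \frac{d}{dt}\int_{\mathbb R^d}\phi(z)f(t,z)\,dz=\int_{\mathbb R^d}\mathcal Kf(t,z)\cdot\nabla\phi(z)\,f(t,z)\,dz,\qquad t\in\mathbb R . $$ For probability measures $\mu,\nu$ on $\mathbb R^d$, let $\Pi(\mu,\nu)$ be the set of Borel probability measures on $\mathbb R^d\times\mathbb R^d$ with first and second marginals $\mu$ and $\nu$, and set $$ \operatorname{dist}_{MK,1}(\mu,\nu)=\inf_{\pi\in\Pi(\mu,\nu)}\iint|x-y|\,\pi(dx\,dy). $$ For $Z_N=(z_1,\dots,z_N)\in(\mathbb R^d)^N$ set $\mu_{Z_N}=\frac1N\sum_{j=1}^N\delta_{z_j}$. Then: (1) For each $N\ge1$ and each $Z_N^{in}=(z_1^{in},\dots,z_N^{in})\in(\mathbb R^d)^N$, the $N$-particle system $$ \dot z_i(t)=\frac1N\sum_{j=1}^NK(z_i(t),z_j(t)),\qquad z_i(0)=z_i^{in},\qquad i=1,\dots,N, $$ has a unique solution $t\mapsto T_tZ_N^{in}=(z_1(t),\dots,z_N(t))$ defined on all of $\mathbb R$. (2) The Cauchy problem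 for the mean-field PDE has a unique weak solution $f\in C(\mathbb R;L^1(\mathbb R^d))$, and $f(t,\cdot)$ is a probability density for each $t\in\mathbb R$. (3) For each $N\ge1$ let $\mathfrak Z(N)\in(\mathbb R^d)^N$ be such that $\operatorname{dist}_{MK,1}(\mu_{\mathfrak Z(N)},f^{in}\,dz)\to0$ as $N\to\infty$. Then, for each $t\in\mathbb R$, $\mu_{T_t\mathfrak Z(N)}\to f(t,\cdot)\,dz$ weakly as $N\to\infty$, that is, $\int\phi\,d\mu_{T_t\mathfrak Z(N)}\to\int\phi(z)f(t,z)\,dz$ for each bounded continuous $\phi:\mathbb R^d\to\mathbb R$; moreover, for each $N\ge1$, $$ \operatorname{dist}_{MK,1}(\mu_{T_t\mathfrak Z(N)},f(t,\cdot)\,dz)\le e^{2L|t|}\operatorname{dist}_{MK,1}(\mu_{\mathfrak Z(N)},f^{in}\,dz), $$ and consequently $\operatorname{dist}_{MK,1}(\mu_{T_t\mathfrak Z(N)},f(t,\cdot)\,dz)\to0$ as $N\to\infty$. -/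

import Mathlib

open MeasureTheory Filter Topology
open scoped ENNReal BoundedContinuousFunction

noncomputable section

namespace MeanField

/-- The phase space `ℝ^d` with its Euclidean norm and Lebesgue measure. -/
abbrev Phase (d : ℕ) : Type := EuclideanSpace ℝ (Fin d)

/-- `K` is of class `C¹` on `ℝ^d × ℝ^d`, skew-symmetric, and both partial differentials are
bounded by `L` (in operator norm). -/
structure IsInteractionKernel {d : ℕ} (K : Phase d → Phase d → Phase d) (L : ℝ) : Prop where
  contDiff : ContDiff ℝ 1 (fun p : Phase d × Phase d => K p.1 p.2)
  skew : ∀ z z', K z z' = -K z' z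
  bound_left : ∀ z z', ‖fderiv ℝ (fun w => K w z') z‖ ≤ L
  bound_right : ∀ z z', ‖fderiv ℝ (fun w => K z w) z'‖ ≤ L

/-- `g` is a probability density with respect to Lebesgue measure. -/
structure IsProbDensity {d : ℕ} (g : Phase d → ℝ) : Prop where
  integrable : Integrable g volume
  nonneg : ∀ᵐ z ∂(volume : Measure (Phase d)), 0 ≤ g z
  integral_eq_one : ∫ z, g z = 1

/-- `∫ |z| |g(z)| dz < ∞`. -/
def HasFiniteFirstMoment {d : ℕ} (g : Phase d → ℝ) : Prop :=
  Integrable (fun z => ‖z‖ * g z) volume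

/-- The measure `g dz` with (nonnegative) density `g`. -/
def densityMeasure {d : ℕ} (g : Phase d → ℝ) : Measure (Phase d) :=
  volume.withDensity (fun z => ENNReal.ofReal (g z))

/-- The mean field velocity `z ↦ ∫ K(z,z') g(z') dz'`. -/
def meanVelocity {d : ℕ} (K : Phase d → Phase d → Phase d) (g : Phase d → ℝ) (z : Phase d) :
    Phase d :=
  ∫ z', g z' • K z z'

/-- The class `C¹_b(ℝ^d)` of bounded `C¹` functions with bounded first derivatives. -/
structure IsC1b {d : ℕ} (φ : Phase d → ℝ) : Prop where
  contDiff : ContDiff ℝ 1 φ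
  bounded : ∃ C : ℝ, ∀ z, |φ z| ≤ C
  fderiv_bounded : ∃ C : ℝ, ∀ z, ‖fderiv ℝ φ z‖ ≤ C

/-- `f ∈ C(ℝ; L¹(ℝ^d))` is a weak solution of `∂ₜ f + div_z (f 𝒦f) = 0` with `f(0) = fin`.
The first moment of each `f(t)` is finite, so that `𝒦f(t)` is defined by convergent integrals.
No sign or mass condition is imposed on `f(t)` for `t ≠ 0`.
In `weak_eq`, `fderiv ℝ φ z v` is `∇φ(z) · v`. -/
structure IsWeakSolution {d : ℕ} (K : Phase d → Phase d → Phase d) (fin : Phase d → ℝ)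
    (f : ℝ → Lp ℝ 1 (volume : Measure (Phase d))) : Prop where
  continuous : Continuous f
  moment : ∀ t, HasFiniteFirstMoment (f t)
  init : f 0 =ᵐ[volume] fin
  weak_eq : ∀ φ : Phase d → ℝ, IsC1b φ → ∀ t : ℝ,
    HasDerivAt (fun s => ∫ z, φ z * f s z)
      (∫ z, fderiv ℝ φ z (meanVelocity K (f t) z) * f t z) t

/-- The empirical measure `(1/N) ∑ⱼ δ_{zⱼ}` of an `N`-tuple. -/
def empirical {d N : ℕ} (z : Fin N → Phase d) : Measure (Phase d) :=
  (N : ℝ≥0∞)⁻¹ • ∑ j, Measure.dirac (z j)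

/-- `π` is a coupling of `μ` and `ν`. -/
def IsCoupling {d : ℕ} (μ ν : Measure (Phase d)) (π : Measure (Phase d × Phase d)) : Prop :=
  π.map Prod.fst = μ ∧ π.map Prod.snd = ν

/-- The Monge-Kantorovich distance of exponent `1`, with values in `[0, ∞]`
(it is finite on pairs of probability measures with finite first moments). -/
def distMK {d : ℕ} (μ ν : Measure (Phase d)) : ℝ≥0∞ :=
  ⨅ (π : Measure (Phase d × Phase d)) (_ : IsCoupling μ ν π), ∫⁻ p, edist p.1 p.2 ∂π

/-- Convergence in the weak topology of probability measures: convergence of the integrals of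
all bounded continuous functions. -/
def WeaklyConverges {d : ℕ} (μ : ℕ → Measure (Phase d)) (ν : Measure (Phase d)) : Prop :=
  ∀ φ : Phase d →ᵇ ℝ, Tendsto (fun N => ∫ z, φ z ∂(μ N)) atTop (𝓝 (∫ z, φ z ∂ν))

/-- `Z` solves, on all of `ℝ`, the `N`-particle system
`żᵢ = (1/N) ∑ⱼ K(zᵢ, zⱼ)` with `Z(0) = z`. -/
def IsParticleSolution {d N : ℕ} (K : Phase d → Phase d → Phase d) (z : Fin N → Phase d)
    (Z : ℝ → Fin N → Phase d) : Prop :=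
  Z 0 = z ∧ ∀ (t : ℝ) (i : Fin N),
    HasDerivAt (fun s => Z s i) ((N : ℝ)⁻¹ • ∑ j, K (Z t i) (Z t j)) t

end MeanField

end

/-! Everything rests on the mean-field characteristic flow: given a probability measure μ with
finite first moment, move each ζ with velocity `∫ K(X_t(ζ), X_t(ζ')) μ(dζ')`. Writing `X_t(ζ) =
(1+|ζ|) u_t(ζ)` with `u_t` bounded and continuous turns this nonlocal equation into an autonomous
ODE with globally Lipschitz right-hand side in a Banach space (`lipschitzWith_flowField`), hence
solvable for all times. Both objects of the theorem are instances. For μ an empirical measure the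
flow evaluated at the atoms is the particle system; for μ with density `fin` the image of μ under
the flow is the weak solution. Once `u` is known the velocity is an ordinary time-dependent C¹
field, so its flow is a C¹ diffeomorphism and the image measure has a density given by the Jacobian
of the inverse flow.

Mean-field limit (Dobrushin). Let a coupling π of the two initial measures be carried by the two
flows. The difference of the flows is a differentiable curve in `L¹(π)` whose derivative is at most
`2L` times its norm: one `L` from the evaluation point of `K`, one from the particles generating the
velocity. Grönwall and the infimum over π give the estimate in Monge-Kantorovich distance; weak
convergence follows by testing against bounded Lipschitz functions.

Uniqueness. A competitor `g` may be signed, and its first moment is finite at each time but not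
assumed locally bounded in time. Let `D(t)` be the dual Lipschitz norm of `g(t) - f(t)`, finite
because the difference has zero mass and a first moment. Testing with functions transported by the
flow of `f` cancels the drift of `f` and leaves `∫ ∇θ · 𝒦(g-f) g`, which is controlled by `D` since
`K(z,·)` is Lipschitz. This yields a Grönwall-type inequality for `D`, but only where `D` is already
bounded. As a supremum of continuous functions `D` is lower semicontinuous; a Baire category
argument (`IsSelfImproving.locally_bounded`) upgrades pointwise finiteness to local boundedness,
after which `D` vanishes step by step. -/

noncomputable section

namespace MeanField

/-! ### Grönwall inequalities and global solvability of globally Lipschitz ODEs -/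

section ODE

variable {E : Type*} [NormedAddCommGroup E] [NormedSpace ℝ E]

/-- Two-sided Grönwall inequality around a base time. -/
theorem norm_le_gronwallBound_abs {f f' : ℝ → E} {K ε T t₀ : ℝ}
    (hf : ∀ t, HasDerivAt f (f' t) t)
    (bound : ∀ t, |t - t₀| ≤ T → ‖f' t‖ ≤ K * ‖f t‖ + ε) {t : ℝ} (ht : |t - t₀| ≤ T) :
    ‖f t‖ ≤ gronwallBound ‖f t₀‖ K ε |t - t₀| := by
  rcases le_total t₀ t with h | h
  · rw [abs_of_nonneg (sub_nonneg.2 h)] at ht ⊢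
    refine norm_le_gronwallBound_of_norm_deriv_right_le (f' := f') (a := t₀) (b := t₀ + T)
      (fun x _ => (hf x).continuousAt.continuousWithinAt)
      (fun x _ => (hf x).hasDerivWithinAt) le_rfl (fun x hx => bound x ?_) t
      ⟨h, by linarith⟩
    rw [abs_of_nonneg (by linarith [hx.1])]; linarith [hx.2]
  · rw [abs_of_nonpos (sub_nonpos.2 h), neg_sub] at ht ⊢
    -- Times before `t₀` are handled by reflecting time about `t₀`.
    have hg : ∀ s, HasDerivAt (fun s => f (2 * t₀ - s)) (-f' (2 * t₀ - s)) s := fun s =>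
      (hf (2 * t₀ - s)).comp_const_sub (2 * t₀) s
    have := norm_le_gronwallBound_of_norm_deriv_right_le (f := fun s => f (2 * t₀ - s))
      (f' := fun s => -f' (2 * t₀ - s)) (a := t₀) (b := t₀ + T) (K := K) (ε := ε)
      (δ := ‖f t₀‖)
      (fun x _ => (hg x).continuousAt.continuousWithinAt)
      (fun x _ => (hg x).hasDerivWithinAt) (by simp [two_mul]) (fun x hx => by
        rw [norm_neg]
        refine bound _ ?_
        rw [abs_of_nonpos (by linarith [hx.1])]; linarith [hx.2]) (2 * t₀ - t)
      ⟨by linarith, by linarith⟩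
    simp only [sub_sub_cancel] at this
    convert this using 2
    ring

/-- Two-sided Grönwall inequality without source term. -/
theorem norm_le_exp_mul_of_norm_deriv_le {f f' : ℝ → E} {K : ℝ} (t₀ : ℝ)
    (hf : ∀ t, HasDerivAt f (f' t) t) (bound : ∀ t, ‖f' t‖ ≤ K * ‖f t‖) (t : ℝ) :
    ‖f t‖ ≤ Real.exp (K * |t - t₀|) * ‖f t₀‖ := by
  have := norm_le_gronwallBound_abs (ε := 0) (T := |t - t₀|) (t₀ := t₀) hf
    (fun t _ => by simpa using bound t) le_rfl
  rwa [gronwallBound_ε0, mul_comm] at this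

variable [CompleteSpace E]

/-- The lifespan `1/(K+1)` depends neither on the starting point nor on the starting time, which is
what makes continuation to all times possible. -/
theorem exists_local_solution {F : ℝ → E → E} {K : NNReal} (hF : ∀ t, LipschitzWith K (F t))
    (hc : ∀ x, Continuous fun t => F t x) (t₀ : ℝ) (x₀ : E) :
    ∃ α : ℝ → E, α t₀ = x₀ ∧
      ∀ t ∈ Set.Ioo (t₀ - 1 / (K + 1)) (t₀ + 1 / (K + 1)), HasDerivAt α (F t (α t)) t := by
  set h : ℝ := 1 / (K + 1) with hh
  have hK : (0 : ℝ) < K + 1 := by positivity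
  have h0 : 0 < h := by positivity
  obtain ⟨B, hB⟩ := (isCompact_Icc (a := t₀ - h) (b := t₀ + h)).exists_bound_of_continuousOn
    (hc x₀).continuousOn
  have hB0 : 0 ≤ B := (norm_nonneg _).trans (hB t₀ ⟨by linarith, by linarith⟩)
  lift B to NNReal using hB0
  -- On the ball of radius `B+1` about `x₀` the speed is at most `B + K(B+1) ≤ (K+1)(B+1)`, so a
  -- trajectory needs at least time `1/(K+1) = h` to leave it.
  have hP : IsPicardLindelof F (tmin := t₀ - h) (tmax := t₀ + h)
      ⟨t₀, by linarith, by linarith⟩ x₀ (B + 1) 0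
      ((K + 1) * (B + 1)) K := by
    refine ⟨fun t _ => (hF t).lipschitzOnWith, fun x _ => (hc x).continuousOn, ?_, ?_⟩
    · intro t ht x hx
      have h1 : ‖F t x - F t x₀‖ ≤ K * (B + 1) := by
        rw [← dist_eq_norm]
        exact ((hF t).dist_le_mul x x₀).trans
          (mul_le_mul_of_nonneg_left (by simpa using hx) K.2)
      have h2 := hB t ht
      have h3 := norm_sub_norm_le (F t x) (F t x₀)
      push_cast
      nlinarith
    · push_cast
      simp only [add_sub_cancel_left, sub_sub_cancel, max_self, sub_zero, hh]
      apply le_of_eq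
      field_simp
  obtain ⟨α, h1, h2⟩ := hP.exists_eq_forall_mem_Icc_hasDerivWithinAt₀
  exact ⟨α, h1, fun t ht => (h2 t ⟨ht.1.le, ht.2.le⟩).hasDerivAt (Icc_mem_nhds ht.1 ht.2)⟩

/-- Continuation by half a lifespan on each side per step; the offset 2 makes the case `n = 0` the
interval of one full lifespan. -/
theorem exists_solution_Ioo {F : ℝ → E → E} {K : NNReal} (hF : ∀ t, LipschitzWith K (F t))
    (hc : ∀ x, Continuous fun t => F t x) (x₀ : E) (n : ℕ) :
    ∃ α : ℝ → E, α 0 = x₀ ∧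
      ∀ t ∈ Set.Ioo (-((n + 2) * (1 / (K + 1) / 2) : ℝ)) ((n + 2) * (1 / (K + 1) / 2)),
        HasDerivAt α (F t (α t)) t := by
  set h : ℝ := 1 / (K + 1) with hh
  have h0 : 0 < h := by positivity
  induction n with
  | zero =>
    obtain ⟨α, h1, h2⟩ := exists_local_solution hF hc 0 x₀
    refine ⟨α, h1, fun t ht => h2 t ?_⟩
    rw [← hh]
    constructor <;> · have := ht.1; have := ht.2; push_cast at *; linarith
  | succ n ih =>
    obtain ⟨α, hα0, hα⟩ := ih
    set a : ℝ := (n + 2) * (h / 2) with ha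
    have hn : (0 : ℝ) ≤ n := n.cast_nonneg
    have hah : h ≤ a := by nlinarith
    have haa : ((n + 1 : ℕ) + 2 : ℝ) * (h / 2) = a + h / 2 := by push_cast; rw [ha]; ring
    rw [haa]
    -- Restarting half a lifespan inside each endpoint leaves overlaps of length `h`, on which
    -- uniqueness identifies old and new solutions.
    obtain ⟨β, hβ0, hβ⟩ := exists_local_solution hF hc (a - h / 2) (α (a - h / 2))
    obtain ⟨γ, hγ0, hγ⟩ := exists_local_solution hF hc (-(a - h / 2)) (α (-(a - h / 2)))
    rw [← hh] at hβ hγ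
    have e1 : Set.EqOn α β (Set.Ioo (a - h) a) :=
      ODE_solution_unique_of_mem_Ioo (v := F) (s := fun _ => Set.univ) (K := K)
        (t₀ := a - h / 2) (fun t _ => (hF t).lipschitzOnWith) ⟨by linarith, by linarith⟩
        (fun t ht => ⟨hα t ⟨by linarith [ht.1], ht.2⟩, trivial⟩)
        (fun t ht => ⟨hβ t ⟨by linarith [ht.1], by linarith [ht.2]⟩, trivial⟩) hβ0.symm
    have e2 : Set.EqOn α γ (Set.Ioo (-a) (-(a - h))) :=
      ODE_solution_unique_of_mem_Ioo (v := F) (s := fun _ => Set.univ) (K := K)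
        (t₀ := -(a - h / 2)) (fun t _ => (hF t).lipschitzOnWith) ⟨by linarith, by linarith⟩
        (fun t ht => ⟨hα t ⟨by linarith [ht.1], by linarith [ht.2]⟩, trivial⟩)
        (fun t ht => ⟨hγ t ⟨by linarith [ht.1], by linarith [ht.2]⟩, trivial⟩) hγ0.symm
    let δ : ℝ → E := fun t => if a - h / 2 ≤ t then β t else if t ≤ -(a - h / 2) then γ t else α t
    have d1 : ∀ t, a - h < t → δ t = β t := by
      intro t ht
      by_cases h1 : a - h / 2 ≤ t
      · simp only [δ, if_pos h1]
      · simp only [δ, if_neg h1]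
        push Not at h1
        rw [if_neg (by linarith)]
        exact e1 ⟨ht, by linarith⟩
    have d2 : ∀ t, t < -(a - h) → δ t = γ t := by
      intro t ht
      by_cases h1 : t ≤ -(a - h / 2)
      · simp only [δ, if_pos h1]
        rw [if_neg (by linarith)]
      · simp only [δ, if_neg h1]
        push Not at h1
        rw [if_neg (by linarith)]
        exact e2 ⟨by linarith, ht⟩
    have d3 : ∀ t ∈ Set.Ioo (-(a - h / 2)) (a - h / 2), δ t = α t := by
      intro t ht
      simp only [δ, if_neg (not_le.2 ht.1), if_neg (not_le.2 ht.2)]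
    refine ⟨δ, by rw [d3 0 ⟨by linarith, by linarith⟩, hα0], fun t ht => ?_⟩
    rcases lt_or_ge (a - h) t with h1 | h1
    · rw [d1 t h1]
      exact (hβ t ⟨by linarith, by linarith [ht.2]⟩).congr_of_eventuallyEq
        ((eventually_gt_nhds h1).mono fun s hs => d1 s hs)
    · rcases lt_or_ge t (-(a - h)) with h2 | h2
      · rw [d2 t h2]
        exact (hγ t ⟨by linarith [ht.1], by linarith⟩).congr_of_eventuallyEq
          ((eventually_lt_nhds h2).mono fun s hs => d2 s hs)
      · have h3 : t ∈ Set.Ioo (-(a - h / 2)) (a - h / 2) := ⟨by linarith, by linarith⟩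
        rw [d3 t h3]
        exact (hα t ⟨by linarith [h3.1], by linarith [h3.2]⟩).congr_of_eventuallyEq
          (Filter.mem_of_superset (Ioo_mem_nhds h3.1 h3.2) fun s hs => d3 s hs)

/-- Global existence for a globally Lipschitz non-autonomous vector field, starting at time `0`. -/
theorem exists_global_solution_zero {F : ℝ → E → E} {K : NNReal} (hF : ∀ t, LipschitzWith K (F t))
    (hc : ∀ x, Continuous fun t => F t x) (x₀ : E) :
    ∃ α : ℝ → E, α 0 = x₀ ∧ ∀ t, HasDerivAt α (F t (α t)) t := by
  choose α hα0 hα using exists_solution_Ioo hF hc x₀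
  set h : ℝ := 1 / (K + 1) / 2 with hh
  have h0 : 0 < h := by positivity
  have mono : ∀ {m n : ℕ}, m ≤ n → (m + 2 : ℝ) * h ≤ (n + 2) * h := fun {m n} hmn => by gcongr
  have agree : ∀ m n : ℕ, m ≤ n →
      Set.EqOn (α m) (α n) (Set.Ioo (-((m + 2) * h)) ((m + 2) * h)) := by
    intro m n hmn
    have := mono hmn
    exact ODE_solution_unique_of_mem_Ioo (v := F) (s := fun _ => Set.univ) (K := K)
      (t₀ := 0) (fun t _ => (hF t).lipschitzOnWith)
      ⟨by simp only [Left.neg_neg_iff]; positivity, by positivity⟩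
      (fun t ht => ⟨hα m t ht, trivial⟩)
      (fun t ht => ⟨hα n t ⟨by linarith [ht.1], by linarith [ht.2]⟩, trivial⟩)
      ((hα0 m).trans (hα0 n).symm)
  let N : ℝ → ℕ := fun t => ⌈|t| / h⌉₊
  have hN : ∀ t, |t| ≤ N t * h := fun t => by
    have := Nat.le_ceil (|t| / h)
    rwa [div_le_iff₀ h0] at this
  have hmem : ∀ t, t ∈ Set.Ioo (-((N t + 2) * h)) ((N t + 2) * h) := fun t => by
    have := abs_le.1 (hN t)
    constructor <;> nlinarith
  refine ⟨fun t => α (N t) t, hα0 _, fun t => ?_⟩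
  refine (hα (N t) t (hmem t)).congr_of_eventuallyEq ?_
  filter_upwards [Ioo_mem_nhds (hmem t).1 (hmem t).2] with s hs
  rcases le_total (N t) (N s) with h1 | h1
  · exact (agree _ _ h1 hs).symm
  · exact agree _ _ h1 (hmem s)

/-- Global existence for a globally Lipschitz non-autonomous vector field. -/
theorem exists_global_solution {F : ℝ → E → E} {K : NNReal} (hF : ∀ t, LipschitzWith K (F t))
    (hc : ∀ x, Continuous fun t => F t x) (t₀ : ℝ) (x₀ : E) :
    ∃ α : ℝ → E, α t₀ = x₀ ∧ ∀ t, HasDerivAt α (F t (α t)) t := by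
  obtain ⟨α, h0, hα⟩ := exists_global_solution_zero (F := fun t => F (t + t₀))
    (fun t => hF _) (fun x => (hc x).comp (by fun_prop)) x₀
  refine ⟨fun t => α (t - t₀), by simpa using h0, fun t => ?_⟩
  simpa using (hα (t - t₀)).comp_sub_const t t₀

end ODE

/-! ### C¹ dependence of flows and of their inverses on time and initial data -/

section Flow

theorem gronwallBound_zero_left (K ε x : ℝ) :
    gronwallBound 0 K ε x = ε * gronwallBound 0 K 1 x := by
  by_cases hK : K = 0
  · subst hK; simp [gronwallBound_K0]
  · simp only [gronwallBound_of_K_ne_0 hK]; ring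

variable {E : Type*} [NormedAddCommGroup E] [NormedSpace ℝ E]

/-- A time dependent vector field, jointly continuous, `C¹` in space with spatial differential `A`
bounded by `L`. -/
structure IsC1Field (V : ℝ → E → E) (A : ℝ → E → E →L[ℝ] E) (L : NNReal) : Prop where
  hasFDerivAt : ∀ t z, HasFDerivAt (V t) (A t z) z
  continuous : Continuous fun p : ℝ × E => V p.1 p.2
  continuous_fderiv : Continuous fun p : ℝ × E => A p.1 p.2
  bound : ∀ t z, ‖A t z‖ ≤ L

/-- `Z t` is the flow map of `V` from time `0` to time `t`. -/
structure IsFlow (V : ℝ → E → E) (Z : ℝ → E → E) : Prop where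
  zero : ∀ x, Z 0 x = x
  hasDerivAt : ∀ x t, HasDerivAt (fun s => Z s x) (V t (Z t x)) t

variable {V : ℝ → E → E} {A : ℝ → E → E →L[ℝ] E} {L : NNReal} {Z : ℝ → E → E}

theorem IsC1Field.lipschitzWith (hV : IsC1Field V A L) (t : ℝ) : LipschitzWith L (V t) :=
  lipschitzWith_of_nnnorm_fderiv_le (fun z => (hV.hasFDerivAt t z).differentiableAt)
    fun z => by rw [(hV.hasFDerivAt t z).fderiv]; exact hV.bound t z

theorem norm_sub_le_of_solutions {v : ℝ → E → E} (hv : ∀ t, LipschitzWith L (v t)) {α β : ℝ → E}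
    (hα : ∀ t, HasDerivAt α (v t (α t)) t) (hβ : ∀ t, HasDerivAt β (v t (β t)) t) (t₀ t : ℝ) :
    ‖α t - β t‖ ≤ Real.exp (L * |t - t₀|) * ‖α t₀ - β t₀‖ :=
  norm_le_exp_mul_of_norm_deriv_le t₀ (f := fun t => α t - β t) (fun t => (hα t).sub (hβ t))
    (fun t => (hv t).norm_sub_le _ _) t

theorem IsFlow.norm_sub_le (hZ : IsFlow V Z) (hV : IsC1Field V A L) (t : ℝ) (x y : E) :
    ‖Z t x - Z t y‖ ≤ Real.exp (L * |t|) * ‖x - y‖ := by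
  simpa [hZ.zero] using norm_sub_le_of_solutions hV.lipschitzWith (hZ.hasDerivAt x)
    (hZ.hasDerivAt y) 0 t

/-- Grönwall run backwards from time `t` to `0`; it yields injectivity of the flow maps and the
Lipschitz bound for their inverses. -/
theorem IsFlow.norm_sub_le' (hZ : IsFlow V Z) (hV : IsC1Field V A L) (t : ℝ) (x y : E) :
    ‖x - y‖ ≤ Real.exp (L * |t|) * ‖Z t x - Z t y‖ := by
  simpa [hZ.zero] using norm_sub_le_of_solutions hV.lipschitzWith (hZ.hasDerivAt x)
    (hZ.hasDerivAt y) t 0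

theorem IsFlow.continuous (hZ : IsFlow V Z) (hV : IsC1Field V A L) :
    Continuous fun p : ℝ × E => Z p.1 p.2 := by
  refine continuous_iff_continuousAt.2 fun ⟨t₀, x₀⟩ => ?_
  rw [ContinuousAt, tendsto_iff_norm_sub_tendsto_zero]
  have h1 : Tendsto (fun p : ℝ × E => Real.exp (L * |p.1|) * ‖p.2 - x₀‖ + ‖Z p.1 x₀ - Z t₀ x₀‖)
      (𝓝 (t₀, x₀)) (𝓝 (Real.exp (L * |t₀|) * ‖x₀ - x₀‖ + ‖Z t₀ x₀ - Z t₀ x₀‖)) := by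
    have hc : Continuous fun t => Z t x₀ :=
      continuous_iff_continuousAt.2 fun t => (hZ.hasDerivAt x₀ t).continuousAt
    have : Continuous (fun p : ℝ × E =>
      Real.exp (L * |p.1|) * ‖p.2 - x₀‖ + ‖Z p.1 x₀ - Z t₀ x₀‖) := by fun_prop
    exact this.tendsto (t₀, x₀)
  simp only [sub_self, norm_zero, mul_zero, add_zero] at h1
  refine squeeze_zero (fun _ => norm_nonneg _) (fun p => ?_) h1
  calc ‖Z p.1 p.2 - Z t₀ x₀‖ ≤ ‖Z p.1 p.2 - Z p.1 x₀‖ + ‖Z p.1 x₀ - Z t₀ x₀‖ :=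
        norm_sub_le_norm_sub_add_norm_sub _ _ _
    _ ≤ _ := by gcongr; exact hZ.norm_sub_le hV _ _ _

/-- The trajectory over `[-T, T]` is compact, so continuity of `A` is uniform along it; this
replaces uniform continuity of `A` in what follows. -/
theorem IsFlow.modulus (hZ : IsFlow V Z) (hV : IsC1Field V A L) (x : E) (T : ℝ) {ω : ℝ}
    (hω : 0 < ω) : ∀ᶠ w in 𝓝 (0 : E), ∀ s ∈ Set.Icc (-T) T,
      ‖A s (Z s x + w) - A s (Z s x)‖ ≤ ω := by
  refine isCompact_Icc.eventually_forall_of_forall_eventually fun s _ => ?_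
  have hc : Continuous fun s => Z s x :=
    continuous_iff_continuousAt.2 fun t => (hZ.hasDerivAt x t).continuousAt
  have h : Continuous fun p : E × ℝ => ‖A p.2 (Z p.2 x + p.1) - A p.2 (Z p.2 x)‖ :=
    ((hV.continuous_fderiv.comp (f := fun p : E × ℝ => (p.2, Z p.2 x + p.1)) (by fun_prop)).sub
      (hV.continuous_fderiv.comp (f := fun p : E × ℝ => (p.2, Z p.2 x)) (by fun_prop))).norm
  have := h.tendsto (0, s)
  simp only [add_zero, sub_self, norm_zero] at this
  exact this.eventually_le_const hω

theorem IsFlow.modulus' (hZ : IsFlow V Z) (hV : IsC1Field V A L) (x : E) (T : ℝ) {ω : ℝ}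
    (hω : 0 < ω) : ∃ δ > 0, ∀ w s, ‖w‖ ≤ δ → |s| ≤ T → ‖A s (Z s x + w) - A s (Z s x)‖ ≤ ω := by
  obtain ⟨δ, hδ, h⟩ := Metric.eventually_nhds_iff_ball.1 (hZ.modulus hV x T hω)
  refine ⟨δ / 2, by positivity, fun w s hw hs => h w ?_ s (abs_le.1 hs)⟩
  simp; linarith

/-- The solutions `J` of the variational equation along the flow. -/
structure IsVariational (A : ℝ → E → E →L[ℝ] E) (Z : ℝ → E → E) (J : ℝ → E → E →L[ℝ] E) :
    Prop where
  zero : ∀ x, J 0 x = ContinuousLinearMap.id ℝ E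
  hasDerivAt : ∀ x t, HasDerivAt (fun s => J s x) ((A t (Z t x)).comp (J t x)) t

theorem IsFlow.exists_isVariational [CompleteSpace E] (hZ : IsFlow V Z) (hV : IsC1Field V A L) :
    ∃ J, IsVariational A Z J := by
  have : ∀ x, ∃ J : ℝ → E →L[ℝ] E, J 0 = ContinuousLinearMap.id ℝ E ∧
      ∀ t, HasDerivAt J ((A t (Z t x)).comp (J t)) t := fun x => by
    refine exists_global_solution (F := fun t M => (A t (Z t x)).comp M) (K := L) (fun t => ?_)
      (fun M => ?_) 0 _
    · refine LipschitzWith.of_dist_le_mul fun M N => ?_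
      rw [dist_eq_norm, dist_eq_norm, ← ContinuousLinearMap.comp_sub]
      exact (ContinuousLinearMap.opNorm_comp_le _ _).trans
        (mul_le_mul_of_nonneg_right (hV.bound _ _) (norm_nonneg _))
    · have hc : Continuous fun s => Z s x :=
        continuous_iff_continuousAt.2 fun t => (hZ.hasDerivAt x t).continuousAt
      exact (hV.continuous_fderiv.comp (f := fun t => (t, Z t x)) (by fun_prop)).clm_comp
        continuous_const
  choose J h0 hJ using this
  exact ⟨fun t x => J x t, h0, hJ⟩

variable {J : ℝ → E → E →L[ℝ] E}

theorem IsVariational.norm_le (hJ : IsVariational A Z J) (hV : IsC1Field V A L) (t : ℝ) (x : E) :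
    ‖J t x‖ ≤ Real.exp (L * |t|) := by
  have := norm_le_exp_mul_of_norm_deriv_le (K := L) 0 (hJ.hasDerivAt x) (fun t =>
    (ContinuousLinearMap.opNorm_comp_le _ _).trans
      (mul_le_mul_of_nonneg_right (hV.bound _ _) (norm_nonneg _))) t
  rw [sub_zero, hJ.zero] at this
  exact this.trans (mul_le_of_le_one_right (Real.exp_pos _).le ContinuousLinearMap.norm_id_le)

/-- A solution `J s x w` of the linear equation that vanishes at time `t` vanishes at time `0`,
where it equals `w`. -/
theorem IsVariational.injective (hJ : IsVariational A Z J) (hV : IsC1Field V A L) (t : ℝ) (x : E) :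
    Function.Injective (J t x) := by
  refine (injective_iff_map_eq_zero _).2 fun w hw => ?_
  have hd : ∀ s, HasDerivAt (fun s => J s x w) (A s (Z s x) (J s x w)) s := fun s => by
    simpa using (hJ.hasDerivAt x s).clm_apply (hasDerivAt_const s w)
  have := norm_le_exp_mul_of_norm_deriv_le (K := L) t hd
    (fun s => (A s (Z s x)).le_of_opNorm_le (hV.bound _ _) _) 0
  simpa [hJ.zero, hw] using this

/-- The linearization error `Z s y - Z s x - J s x (y - x)` starts from zero and solves the
variational equation up to a source that is `o(|y - x|)`, so Grönwall keeps it `o(|y - x|)`. -/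
theorem IsVariational.hasFDerivAt (hJ : IsVariational A Z J) (hZ : IsFlow V Z)
    (hV : IsC1Field V A L) (t : ℝ) (x : E) : HasFDerivAt (Z t) (J t x) x := by
  rw [hasFDerivAt_iff_isLittleO, Asymptotics.isLittleO_iff]
  intro c hc
  set M := Real.exp (L * |t|) with hM
  have hM0 : 0 < M := Real.exp_pos _
  set C := abs (gronwallBound 0 (L : ℝ) 1 |t|) with hC
  have hC0 : 0 ≤ C := abs_nonneg _
  -- The source is at most this modulus times `M * ‖y - x‖` and Grönwall multiplies it by at most
  -- `C`; the choice makes the product at most `c * ‖y - x‖`.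
  obtain ⟨δ, hδ, h⟩ := hZ.modulus' hV x |t| (ω := c / (M * (C + 1))) (by positivity)
  filter_upwards [Metric.ball_mem_nhds x (ε := δ / M) (by positivity)] with y hy
  rw [mem_ball_iff_norm, lt_div_iff₀ hM0] at hy
  have hr : ∀ s, HasDerivAt (fun s => Z s y - Z s x - J s x (y - x))
      (V s (Z s y) - V s (Z s x) - A s (Z s x) (J s x (y - x))) s := fun s => by
    simpa using ((hZ.hasDerivAt y s).fun_sub (hZ.hasDerivAt x s)).fun_sub
      ((hJ.hasDerivAt x s).clm_apply (hasDerivAt_const s (y - x)))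
  have key := norm_le_gronwallBound_abs (K := L) (ε := c / (M * (C + 1)) * (M * ‖y - x‖))
    (T := |t|) (t₀ := 0) hr (fun s hs => by
      rw [sub_zero] at hs
      have hMs : Real.exp (L * |s|) ≤ M := by rw [hM]; gcongr
      have h1 : ‖Z s y - Z s x‖ ≤ M * ‖y - x‖ :=
        (hZ.norm_sub_le hV s y x).trans (by gcongr)
      have h2 : ‖V s (Z s y) - V s (Z s x) - A s (Z s x) (Z s y - Z s x)‖ ≤
          c / (M * (C + 1)) * ‖Z s y - Z s x‖ := by
        refine Convex.norm_image_sub_le_of_norm_hasFDerivWithin_le'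
          (s := Metric.closedBall (Z s x) (M * ‖y - x‖)) (f' := fun z => A s z)
          (fun z _ => (hV.hasFDerivAt s z).hasFDerivWithinAt) (fun z hz => ?_)
          (convex_closedBall _ _) (Metric.mem_closedBall_self (by positivity))
          (by rwa [mem_closedBall_iff_norm])
        rw [mem_closedBall_iff_norm] at hz
        have := h (z - Z s x) s (by linarith) hs
        rwa [add_sub_cancel] at this
      have h3 : V s (Z s y) - V s (Z s x) - A s (Z s x) (J s x (y - x)) =
          A s (Z s x) (Z s y - Z s x - J s x (y - x)) +
          (V s (Z s y) - V s (Z s x) - A s (Z s x) (Z s y - Z s x)) := by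
        simp only [map_sub]; abel
      rw [h3]
      refine (norm_add_le _ _).trans (add_le_add
        ((A s (Z s x)).le_of_opNorm_le (hV.bound _ _) _) (h2.trans ?_))
      gcongr) (t := t) (by simp)
  rw [sub_zero, hJ.zero, hZ.zero, hZ.zero, ContinuousLinearMap.id_apply, sub_self, norm_zero,
    gronwallBound_zero_left] at key
  refine key.trans ((mul_le_mul_of_nonneg_left (le_abs_self _) (by positivity)).trans ?_)
  rw [← hC]
  have : c / (M * (C + 1)) * (M * ‖y - x‖) * C = c * ‖y - x‖ * (C / (C + 1)) := by
    field_simp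
  rw [this]
  exact mul_le_of_le_one_right (by positivity) ((div_le_one (by positivity)).2 (by linarith))

/-- The same Grönwall argument applied to `J s y - J s x`, uniformly for `|s| ≤ T`, combined with
continuity in time at fixed `x`. -/
theorem IsVariational.continuous (hJ : IsVariational A Z J) (hZ : IsFlow V Z)
    (hV : IsC1Field V A L) : Continuous fun p : ℝ × E => J p.1 p.2 := by
  refine continuous_iff_continuousAt.2 fun ⟨t₀, x⟩ => ?_
  set T := |t₀| + 1 with hT
  set M := Real.exp (L * T) with hM
  have hM0 : 0 < M := Real.exp_pos _
  set C := abs (gronwallBound 0 (L : ℝ) 1 T) with hC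
  have hC0 : 0 ≤ C := abs_nonneg _
  have hJc : Continuous fun s => J s x :=
    continuous_iff_continuousAt.2 fun t => (hJ.hasDerivAt x t).continuousAt
  rw [ContinuousAt, Metric.tendsto_nhds]
  intro ε hε
  set ω := ε / 2 / (M * (C + 1)) with hω
  obtain ⟨δ, hδ, h⟩ := hZ.modulus' hV x T (ω := ω) (by positivity)
  have e1 : ∀ᶠ p : ℝ × E in 𝓝 (t₀, x), |p.1| ≤ T :=
    (continuous_fst.abs.tendsto (t₀, x)).eventually_le_const (by simp [hT])
  have e2 : ∀ᶠ p : ℝ × E in 𝓝 (t₀, x), ‖p.2 - x‖ < δ / M := by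
    have : Continuous fun p : ℝ × E => ‖p.2 - x‖ := by fun_prop
    exact (this.tendsto (t₀, x)).eventually_lt_const (by simp; positivity)
  have e3 : ∀ᶠ p : ℝ × E in 𝓝 (t₀, x), ‖J p.1 x - J t₀ x‖ < ε / 2 := by
    have : Continuous fun p : ℝ × E => ‖J p.1 x - J t₀ x‖ := by fun_prop
    exact (this.tendsto (t₀, x)).eventually_lt_const (by simp; positivity)
  filter_upwards [e1, e2, e3] with ⟨t, y⟩ h1 h2 h3
  simp only at h1 h2 h3
  rw [lt_div_iff₀ hM0] at h2
  have hr : ∀ s, HasDerivAt (fun s => J s y - J s x)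
      ((A s (Z s y)).comp (J s y) - (A s (Z s x)).comp (J s x)) s := fun s =>
    (hJ.hasDerivAt y s).sub (hJ.hasDerivAt x s)
  have key := norm_le_gronwallBound_abs (K := L) (ε := ω * M)
    (T := T) (t₀ := 0) hr (fun s hs => by
      rw [sub_zero] at hs
      have hMs : Real.exp (L * |s|) ≤ M := by rw [hM]; gcongr
      have h4 : ‖Z s y - Z s x‖ ≤ M * ‖y - x‖ :=
        (hZ.norm_sub_le hV s y x).trans (by gcongr)
      have h5 := h (Z s y - Z s x) s (by linarith) hs
      rw [add_sub_cancel] at h5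
      have h6 : (A s (Z s y)).comp (J s y) - (A s (Z s x)).comp (J s x) =
          (A s (Z s y)).comp (J s y - J s x) + (A s (Z s y) - A s (Z s x)).comp (J s x) := by
        ext w; simp
      rw [h6]
      refine (norm_add_le _ _).trans (add_le_add
        ((ContinuousLinearMap.opNorm_comp_le _ _).trans
          (mul_le_mul_of_nonneg_right (hV.bound _ _) (norm_nonneg _)))
        ((ContinuousLinearMap.opNorm_comp_le _ _).trans
          (mul_le_mul h5 ((hJ.norm_le hV s x).trans hMs) (norm_nonneg _) (by positivity)))))
      (t := t) (by simpa using h1)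
  rw [sub_zero, hJ.zero, hJ.zero, sub_self, norm_zero, gronwallBound_zero_left] at key
  have h7 : gronwallBound 0 (L : ℝ) 1 |t| ≤ C :=
    (gronwallBound_mono le_rfl zero_le_one L.2 h1).trans (le_abs_self _)
  have h8 : ‖J t y - J t x‖ ≤ ε / 2 := by
    refine key.trans ((mul_le_mul_of_nonneg_left h7 (by positivity)).trans ?_)
    have : ω * M * C = ε / 2 * (C / (C + 1)) := by rw [hω]; field_simp
    rw [this]
    exact mul_le_of_le_one_right (by positivity) ((div_le_one (by positivity)).2 (by linarith))
  rw [dist_eq_norm]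
  calc ‖J t y - J t₀ x‖ ≤ ‖J t y - J t x‖ + ‖J t x - J t₀ x‖ :=
        norm_sub_le_norm_sub_add_norm_sub _ _ _
    _ < ε := by linarith

theorem contDiff_one_of_partial {F G H : Type*} [NormedAddCommGroup F] [NormedSpace ℝ F]
    [NormedAddCommGroup G] [NormedSpace ℝ G] [NormedAddCommGroup H] [NormedSpace ℝ H]
    {f : F → G → H} {f₁ : F → G → F →L[ℝ] H} {f₂ : F → G → G →L[ℝ] H}
    (h₁ : ∀ x y, HasFDerivAt (fun x => f x y) (f₁ x y) x)
    (h₂ : ∀ x y, HasFDerivAt (f x) (f₂ x y) y)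
    (c₁ : Continuous fun p : F × G => f₁ p.1 p.2) (c₂ : Continuous fun p : F × G => f₂ p.1 p.2) :
    (∀ p : F × G, HasFDerivAt (fun p : F × G => f p.1 p.2)
      ((f₁ p.1 p.2).coprod (f₂ p.1 p.2)) p) ∧ ContDiff ℝ 1 fun p : F × G => f p.1 p.2 := by
  have h : ∀ p : F × G, HasFDerivAt (fun p : F × G => f p.1 p.2)
      ((f₁ p.1 p.2).coprod (f₂ p.1 p.2)) p := fun p =>
    (hasStrictFDerivAt_uncurry_coprod (f := f) (f₁ := f₁) (f₂ := f₂) (u := p)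
      (Eventually.of_forall fun v => h₁ v.1 v.2)
      (Eventually.of_forall fun v => h₂ v.1 v.2) c₁.continuousAt c₂.continuousAt).hasFDerivAt
  refine ⟨h, contDiff_one_iff_fderiv.2 ⟨fun p => (h p).differentiableAt, ?_⟩⟩
  rw [show fderiv ℝ (fun p : F × G => f p.1 p.2) = fun p => (f₁ p.1 p.2).coprod (f₂ p.1 p.2) from
    funext fun p => (h p).fderiv]
  have : ∀ p : F × G, (f₁ p.1 p.2).coprod (f₂ p.1 p.2) =
      (f₁ p.1 p.2).comp (ContinuousLinearMap.fst ℝ F G) +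
      (f₂ p.1 p.2).comp (ContinuousLinearMap.snd ℝ F G) := fun p => by ext <;> simp
  simp_rw [this]
  fun_prop

theorem IsFlow.contDiff [CompleteSpace E] (hZ : IsFlow V Z) (hV : IsC1Field V A L) :
    ContDiff ℝ 1 fun p : ℝ × E => Z p.1 p.2 := by
  obtain ⟨J, hJ⟩ := hZ.exists_isVariational hV
  have hc := hZ.continuous hV
  refine (contDiff_one_of_partial (f := Z)
    (f₁ := fun t x => ContinuousLinearMap.toSpanSingleton ℝ (V t (Z t x)))
    (fun t x => (hZ.hasDerivAt x t).hasFDerivAt) (fun t x => hJ.hasFDerivAt hZ hV t x) ?_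
    (hJ.continuous hZ hV)).2
  have h1 : Continuous fun p : ℝ × E => V p.1 (Z p.1 p.2) :=
    hV.continuous.comp (f := fun p : ℝ × E => (p.1, Z p.1 p.2)) (by fun_prop)
  exact (ContinuousLinearMap.toSpanSingletonCLE (𝕜 := ℝ) (E := E)).continuous.comp h1

theorem IsFlow.injective (hZ : IsFlow V Z) (hV : IsC1Field V A L) (t : ℝ) :
    Function.Injective (Z t) := fun x y hxy => by
  have := hZ.norm_sub_le' hV t x y
  rw [hxy, sub_self, norm_zero, mul_zero] at this
  exact sub_eq_zero.1 (norm_le_zero_iff.1 this)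

/-- Solve the equation backwards from `(t, x)`; by uniqueness the value at time `0` is a preimage.
-/
theorem IsFlow.surjective [CompleteSpace E] (hZ : IsFlow V Z) (hV : IsC1Field V A L) (t : ℝ) :
    Function.Surjective (Z t) := fun x => by
  obtain ⟨α, hα, hα'⟩ := exists_global_solution hV.lipschitzWith
    (fun z => hV.continuous.comp (f := fun t => (t, z)) (by fun_prop)) t x
  refine ⟨α 0, ?_⟩
  have := norm_sub_le_of_solutions hV.lipschitzWith (hZ.hasDerivAt (α 0)) hα' 0 t
  rw [hZ.zero, sub_self, norm_zero, mul_zero] at this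
  rw [← hα]
  exact sub_eq_zero.1 (norm_le_zero_iff.1 this)

/-- `Y` is the family of inverses of the flow maps `Z`. -/
structure IsInverseFlow (Z Y : ℝ → E → E) : Prop where
  left_inv : ∀ t x, Y t (Z t x) = x
  right_inv : ∀ t x, Z t (Y t x) = x

theorem IsFlow.exists_inverse [CompleteSpace E] (hZ : IsFlow V Z) (hV : IsC1Field V A L) :
    ∃ Y, IsInverseFlow Z Y :=
  ⟨fun t => Function.surjInv (hZ.surjective hV t),
    fun t => Function.leftInverse_surjInv ⟨hZ.injective hV t, hZ.surjective hV t⟩,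
    fun t => Function.rightInverse_surjInv (hZ.surjective hV t)⟩

variable {Y : ℝ → E → E}

theorem IsInverseFlow.norm_sub_le (hY : IsInverseFlow Z Y) (hZ : IsFlow V Z)
    (hV : IsC1Field V A L) (t : ℝ) (x y : E) :
    ‖Y t x - Y t y‖ ≤ Real.exp (L * |t|) * ‖x - y‖ := by
  simpa [hY.right_inv] using hZ.norm_sub_le' hV t (Y t x) (Y t y)

/-- With `y = Y t₀ x₀ = Y t (Z t y)`, the Lipschitz bound gives `|Y t x - y| ≤ e^{L|t|} |x - Z t
y|`, which tends to zero. -/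
theorem IsInverseFlow.continuous (hY : IsInverseFlow Z Y) (hZ : IsFlow V Z)
    (hV : IsC1Field V A L) : Continuous fun p : ℝ × E => Y p.1 p.2 := by
  refine continuous_iff_continuousAt.2 fun ⟨t₀, x₀⟩ => ?_
  rw [ContinuousAt, tendsto_iff_norm_sub_tendsto_zero]
  set y := Y t₀ x₀ with hy
  have h1 : Continuous fun p : ℝ × E => Real.exp (L * |p.1|) * ‖p.2 - Z p.1 y‖ := by
    have hc : Continuous fun t => Z t y :=
      continuous_iff_continuousAt.2 fun t => (hZ.hasDerivAt y t).continuousAt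
    fun_prop
  have h2 := h1.tendsto (t₀, x₀)
  simp only [hy, hY.right_inv, sub_self, norm_zero, mul_zero] at h2
  refine squeeze_zero (fun _ => norm_nonneg _) (fun p => ?_) h2
  have := hY.norm_sub_le hZ hV p.1 p.2 (Z p.1 y)
  rwa [hY.left_inv] at this

/-- Joint regularity in time and space comes from inverting the space-time homeomorphism `(t, x) ↦
(t, Z t x)`, whose differential is block triangular with diagonal blocks `1` and `J`. -/
theorem IsInverseFlow.contDiff [FiniteDimensional ℝ E] [CompleteSpace E]
    (hY : IsInverseFlow Z Y) (hZ : IsFlow V Z)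
    (hV : IsC1Field V A L) : ContDiff ℝ 1 fun p : ℝ × E => Y p.1 p.2 := by
  obtain ⟨J, hJ⟩ := hZ.exists_isVariational hV
  let Ψ : ℝ × E ≃ₜ ℝ × E :=
    { toFun := fun p => (p.1, Z p.1 p.2)
      invFun := fun p => (p.1, Y p.1 p.2)
      left_inv := fun p => by simp [hY.left_inv]
      right_inv := fun p => by simp [hY.right_inv]
      continuous_toFun := continuous_fst.prodMk (hZ.continuous hV)
      continuous_invFun := continuous_fst.prodMk (hY.continuous hZ hV) }
  have hΨ : ContDiff ℝ 1 Ψ := contDiff_fst.prodMk (hZ.contDiff hV)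
  have hd : ∀ p, HasFDerivAt Ψ (fderiv ℝ Ψ p) p := fun p =>
    (hΨ.differentiable one_ne_zero p).hasFDerivAt
  -- A kernel vector has zero time component because `Ψ` preserves time; its space component is then
  -- killed by the injective `J`. In finite dimension injectivity suffices.
  have hinj : ∀ p, Function.Injective (fderiv ℝ Ψ p) := fun p => by
    refine (injective_iff_map_eq_zero _).2 fun w hw => ?_
    have e1 : w.1 = 0 := by
      have h1 : HasFDerivAt (fun q => (Ψ q).1)
          ((ContinuousLinearMap.fst ℝ ℝ E).comp (fderiv ℝ Ψ p)) p := (hd p).fst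
      have h2 : HasFDerivAt (fun q : ℝ × E => (Ψ q).1) (ContinuousLinearMap.fst ℝ ℝ E) p :=
        hasFDerivAt_fst
      have := congrArg (fun M => M w) (h1.unique h2)
      simpa [hw] using this.symm
    have e2 : J p.1 p.2 w.2 = 0 := by
      have h1 : HasFDerivAt (fun y => Ψ (p.1, y))
          ((fderiv ℝ Ψ p).comp (ContinuousLinearMap.inr ℝ ℝ E)) p.2 :=
        HasFDerivAt.comp p.2 (hd (p.1, p.2)) (hasFDerivAt_prodMk_right p.1 p.2)
      have := congrArg (fun M => M w.2) (h1.snd.unique (hJ.hasFDerivAt hZ hV p.1 p.2))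
      have hw' : w = (0, w.2) := Prod.ext e1 rfl
      simp only [ContinuousLinearMap.comp_apply, ContinuousLinearMap.inr_apply] at this
      rw [← hw', hw] at this
      simpa using this.symm
    have e3 : w.2 = 0 := hJ.injective hV p.1 p.2 (by simp [e2])
    exact Prod.ext e1 e3
  let Φ : ℝ × E → (ℝ × E) ≃L[ℝ] (ℝ × E) := fun p =>
    (LinearEquiv.ofInjectiveEndo (fderiv ℝ Ψ p : ℝ × E →ₗ[ℝ] ℝ × E) (hinj p)).toContinuousLinearEquiv
  have hΦ : ∀ p, HasFDerivAt Ψ (Φ p : ℝ × E →L[ℝ] ℝ × E) p := fun p => by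
    convert! hd p
  exact contDiff_snd.comp (Ψ.contDiff_symm hΦ hΨ)

/-- The inverse flow is constant along trajectories. -/
theorem IsInverseFlow.fderiv_apply [FiniteDimensional ℝ E] [CompleteSpace E]
    (hY : IsInverseFlow Z Y) (hZ : IsFlow V Z)
    (hV : IsC1Field V A L) (t : ℝ) (x : E) :
    fderiv ℝ (fun p : ℝ × E => Y p.1 p.2) (t, x) (1, V t x) = 0 := by
  have h1 : HasFDerivAt (fun p : ℝ × E => Y p.1 p.2) _ (t, Z t (Y t x)) :=
    ((hY.contDiff hZ hV).differentiable one_ne_zero _).hasFDerivAt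
  have h2 : HasDerivAt (fun s => (s, Z s (Y t x))) (1, V t (Z t (Y t x))) t :=
    (hasDerivAt_id t).prodMk (hZ.hasDerivAt _ t)
  have h3 := h1.comp_hasDerivAt t h2
  have h4 : (fun p : ℝ × E => Y p.1 p.2) ∘ (fun s => (s, Z s (Y t x))) = fun _ => Y t x :=
    funext fun s => by simp [hY.left_inv]
  rw [h4] at h3
  have := h3.unique (hasDerivAt_const t (Y t x))
  rwa [hY.right_inv] at this

end Flow

/-! ### Lipschitz and growth bounds for the interaction kernel -/

section Kernel

variable {d : ℕ} {K : Phase d → Phase d → Phase d} {L : ℝ}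

theorem IsInteractionKernel.nonneg (hK : IsInteractionKernel K L) : 0 ≤ L :=
  (norm_nonneg _).trans (hK.bound_left 0 0)

theorem IsInteractionKernel.self (hK : IsInteractionKernel K L) (z : Phase d) : K z z = 0 := by
  have h : (2 : ℝ) • K z z = 0 := by
    rw [two_smul]; nth_rewrite 1 [hK.skew]; simp
  simpa using h

theorem IsInteractionKernel.continuous (hK : IsInteractionKernel K L) :
    Continuous fun p : Phase d × Phase d => K p.1 p.2 := hK.contDiff.continuous

theorem IsInteractionKernel.contDiff_left (hK : IsInteractionKernel K L) (w : Phase d) :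
    ContDiff ℝ 1 fun z => K z w :=
  hK.contDiff.comp (f := fun z => (z, w)) (by fun_prop)

theorem IsInteractionKernel.contDiff_right (hK : IsInteractionKernel K L) (z : Phase d) :
    ContDiff ℝ 1 fun w => K z w :=
  hK.contDiff.comp (f := fun w => (z, w)) (by fun_prop)

theorem IsInteractionKernel.norm_sub_le_left (hK : IsInteractionKernel K L) (w z z' : Phase d) :
    ‖K z w - K z' w‖ ≤ L * ‖z - z'‖ :=
  Convex.norm_image_sub_le_of_norm_fderiv_le (s := Set.univ) (f := fun z => K z w)
    (fun z _ => (hK.contDiff_left w).differentiable one_ne_zero z)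
    (fun z _ => hK.bound_left z w) convex_univ trivial trivial

theorem IsInteractionKernel.norm_sub_le_right (hK : IsInteractionKernel K L) (z w w' : Phase d) :
    ‖K z w - K z w'‖ ≤ L * ‖w - w'‖ :=
  Convex.norm_image_sub_le_of_norm_fderiv_le (s := Set.univ) (f := fun w => K z w)
    (fun w _ => (hK.contDiff_right z).differentiable one_ne_zero w)
    (fun w _ => hK.bound_right z w) convex_univ trivial trivial

theorem IsInteractionKernel.norm_sub_le (hK : IsInteractionKernel K L) (z w z' w' : Phase d) :
    ‖K z w - K z' w'‖ ≤ L * ‖z - z'‖ + L * ‖w - w'‖ :=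
  (norm_sub_le_norm_sub_add_norm_sub _ (K z' w) _).trans
    (add_le_add (hK.norm_sub_le_left _ _ _) (hK.norm_sub_le_right _ _ _))

/-- Skew-symmetry makes `K` vanish on the diagonal, so `|K(z,w)| ≤ L|z - w|`. This is the only role
of skew-symmetry. -/
theorem IsInteractionKernel.norm_le (hK : IsInteractionKernel K L) (z w : Phase d) :
    ‖K z w‖ ≤ L * (‖z‖ + ‖w‖) := by
  have := hK.norm_sub_le_left w z w
  rw [hK.self, sub_zero] at this
  exact this.trans (mul_le_mul_of_nonneg_left (_root_.norm_sub_le _ _) hK.nonneg)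

theorem IsInteractionKernel.hasFDerivAt_left (hK : IsInteractionKernel K L) (z w : Phase d) :
    HasFDerivAt (fun z => K z w) (fderiv ℝ (fun z => K z w) z) z :=
  ((hK.contDiff_left w).differentiable one_ne_zero z).hasFDerivAt

theorem IsInteractionKernel.continuous_fderiv_left (hK : IsInteractionKernel K L) :
    Continuous fun p : Phase d × Phase d => fderiv ℝ (fun z => K z p.2) p.1 := by
  have h : ∀ p : Phase d × Phase d, fderiv ℝ (fun z => K z p.2) p.1 =
      (fderiv ℝ (fun p : Phase d × Phase d => K p.1 p.2) p).comp
        (ContinuousLinearMap.inl ℝ _ _) := fun p =>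
    (HasFDerivAt.comp (g := fun p : Phase d × Phase d => K p.1 p.2) (f := fun z => (z, p.2)) p.1
      (hK.contDiff.differentiable one_ne_zero (p.1, p.2)).hasFDerivAt
      (hasFDerivAt_prodMk_left p.1 p.2)).fderiv
  simp_rw [h]
  exact (hK.contDiff.continuous_fderiv one_ne_zero).clm_comp continuous_const

end Kernel

/-! ### Velocity fields generated by a random particle -/

section Velocity

variable {d : ℕ} {K : Phase d → Phase d → Phase d} {L : ℝ}
variable {Ω : Type*} [MeasurableSpace Ω] {μ : Measure Ω}

/-- The velocity at `z` generated by particles distributed according to the image of `μ`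
under `X`. -/
def velocity (K : Phase d → Phase d → Phase d) (μ : Measure Ω) (X : Ω → Phase d)
    (z : Phase d) : Phase d :=
  ∫ ζ, K z (X ζ) ∂μ

variable [IsProbabilityMeasure μ]

theorem IsInteractionKernel.integrable_comp (hK : IsInteractionKernel K L) {X : Ω → Phase d}
    (hX : Integrable X μ) (z : Phase d) : Integrable (fun ζ => K z (X ζ)) μ := by
  refine Integrable.mono' (((integrable_const ‖z‖).add hX.norm).const_mul L)
    (hK.continuous.comp_aestronglyMeasurable₂ aestronglyMeasurable_const hX.1) ?_
  exact Eventually.of_forall fun ζ => hK.norm_le _ _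

/-- The source of the rate `2L`: one `L` for moving the evaluation point, one for moving the
particles that generate the field. Both fields are integrals over the same `Ω`, so the estimate
holds under the integral sign. -/
theorem IsInteractionKernel.norm_velocity_sub_le (hK : IsInteractionKernel K L)
    {X Y : Ω → Phase d} (hX : Integrable X μ) (hY : Integrable Y μ) (z w : Phase d) :
    ‖velocity K μ X z - velocity K μ Y w‖ ≤ L * ‖z - w‖ + L * ∫ ζ, ‖X ζ - Y ζ‖ ∂μ := by
  have hi : Integrable (fun ζ => ‖X ζ - Y ζ‖) μ := (hX.sub hY).norm
  rw [velocity, velocity, ← integral_sub (hK.integrable_comp hX z) (hK.integrable_comp hY w)]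
  refine (norm_integral_le_of_norm_le (g := fun ζ => L * ‖z - w‖ + L * ‖X ζ - Y ζ‖)
    ((integrable_const _).add (hi.const_mul L))
    (Eventually.of_forall fun ζ => hK.norm_sub_le _ _ _ _)).trans ?_
  rw [integral_add (integrable_const _) (hi.const_mul L)]
  simp [integral_const_mul]

theorem IsInteractionKernel.norm_velocity_le (hK : IsInteractionKernel K L)
    {X : Ω → Phase d} (hX : Integrable X μ) (z : Phase d) :
    ‖velocity K μ X z‖ ≤ L * ‖z‖ + L * ∫ ζ, ‖X ζ‖ ∂μ := by
  refine (norm_integral_le_of_norm_le (g := fun ζ => L * ‖z‖ + L * ‖X ζ‖)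
    ((integrable_const _).add (hX.norm.const_mul L))
    (Eventually.of_forall fun ζ => (hK.norm_le _ _).trans_eq (mul_add _ _ _))).trans ?_
  rw [integral_add (integrable_const _) (hX.norm.const_mul L)]
  simp [integral_const_mul]

end Velocity

/-! ### The mean-field characteristic flow as an ODE in a weighted Banach space -/

section WeightedSpace

variable {d : ℕ} {K : Phase d → Phase d → Phase d} {L : ℝ}

/-- The map of linear growth represented by a bounded continuous function. -/
def unweight (u : Phase d →ᵇ Phase d) (ζ : Phase d) : Phase d := (1 + ‖ζ‖) • u ζ

theorem unweight_sub (u v : Phase d →ᵇ Phase d) (ζ : Phase d) :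
    unweight (u - v) ζ = unweight u ζ - unweight v ζ := by simp [unweight, smul_sub]

theorem norm_unweight_le (u : Phase d →ᵇ Phase d) (ζ : Phase d) :
    ‖unweight u ζ‖ ≤ (1 + ‖ζ‖) * ‖u‖ := by
  have : 0 ≤ 1 + ‖ζ‖ := by positivity
  rw [unweight, norm_smul, Real.norm_of_nonneg this]
  exact mul_le_mul_of_nonneg_left (u.norm_coe_le_norm ζ) this

theorem continuous_unweight (u : Phase d →ᵇ Phase d) : Continuous (unweight u) := by
  unfold unweight; fun_prop

variable {Ω : Type*} [MeasurableSpace Ω] {π : Measure Ω} [IsFiniteMeasure π]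

theorem integrable_unweight_comp {g : Ω → Phase d} (hg : Integrable g π) (u : Phase d →ᵇ Phase d) :
    Integrable (fun ω => unweight u (g ω)) π :=
  Integrable.mono' (((integrable_const 1).add hg.norm).mul_const ‖u‖)
    ((continuous_unweight u).comp_aestronglyMeasurable hg.1)
    (Eventually.of_forall fun _ => norm_unweight_le _ _)

theorem integral_norm_unweight_comp_le {g : Ω → Phase d} (hg : Integrable g π)
    (u : Phase d →ᵇ Phase d) :
    ∫ ω, ‖unweight u (g ω)‖ ∂π ≤ (∫ ω, (1 + ‖g ω‖) ∂π) * ‖u‖ := by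
  rw [← integral_mul_const]
  exact integral_mono (integrable_unweight_comp hg u).norm
    (((integrable_const 1).add hg.norm).mul_const _) fun _ => norm_unweight_le _ _

variable {μ : Measure (Phase d)} [IsProbabilityMeasure μ]

theorem integrable_unweight (hμ : Integrable id μ) (u : Phase d →ᵇ Phase d) :
    Integrable (unweight u) μ := integrable_unweight_comp (g := id) hμ u

/-- The mean field vector field on the space of flow maps of linear growth. -/
def flowField (hK : IsInteractionKernel K L) (hμ : Integrable id μ) (u : Phase d →ᵇ Phase d) :
    Phase d →ᵇ Phase d :=
  BoundedContinuousFunction.ofNormedAddCommGroup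
    (fun ζ => (1 + ‖ζ‖)⁻¹ • velocity K μ (unweight u) (unweight u ζ))
    (by
      have h1 : Continuous (velocity K μ (unweight u)) :=
        (LipschitzWith.of_dist_le_mul (K := L.toNNReal) fun z w => by
          rw [Real.coe_toNNReal _ hK.nonneg]
          have := hK.norm_velocity_sub_le (integrable_unweight hμ u) (integrable_unweight hμ u) z w
          simpa [dist_eq_norm] using this).continuous
      have h2 := continuous_unweight u
      refine Continuous.smul (Continuous.inv₀ (f := fun ζ : Phase d => 1 + ‖ζ‖) (by fun_prop)
        fun ζ => ?_) (h1.comp h2)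
      positivity)
    (L * (1 + ∫ ζ, (1 + ‖ζ‖) ∂μ) * ‖u‖)
    (fun ζ => by
      have h0 : 0 < 1 + ‖ζ‖ := by positivity
      rw [norm_smul, norm_inv, Real.norm_of_nonneg h0.le, inv_mul_le_iff₀ h0]
      have h1 := hK.norm_velocity_le (integrable_unweight hμ u) (unweight u ζ)
      have h2 := integral_norm_unweight_comp_le (g := id) hμ u
      have h3 := norm_unweight_le u ζ
      simp only [id] at h2
      set m := ∫ ζ, (1 + ‖ζ‖) ∂μ
      have hm : 0 ≤ m := integral_nonneg fun ζ => by positivity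
      have hL := hK.nonneg
      -- The contribution of the other particles is constant in `ζ` and is absorbed by the weight,
      -- which is at least 1.
      have h5 : L * (m * ‖u‖) ≤ (1 + ‖ζ‖) * (L * (m * ‖u‖)) :=
        le_mul_of_one_le_left (by positivity) (by simp)
      calc _ ≤ L * ((1 + ‖ζ‖) * ‖u‖) + L * (m * ‖u‖) := by
            refine h1.trans ?_; gcongr
        _ ≤ L * ((1 + ‖ζ‖) * ‖u‖) + (1 + ‖ζ‖) * (L * (m * ‖u‖)) := by
            gcongr
        _ = _ := by ring)

theorem unweight_flowField (hK : IsInteractionKernel K L) (hμ : Integrable id μ)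
    (u : Phase d →ᵇ Phase d) (ζ : Phase d) :
    unweight (flowField hK hμ u) ζ = velocity K μ (unweight u) (unweight u ζ) := by
  have h0 : 1 + ‖ζ‖ ≠ 0 := by positivity
  simp [unweight, flowField, smul_smul, mul_inv_cancel₀ h0]

/-- The evaluation point moves by at most `(1+‖ζ‖) ‖u - v‖` and the generating particles by at most
`m ‖u - v‖` on average; after division by the weight both are uniform in `ζ`. The first moment of
`μ` enters through `m`. -/
theorem lipschitzWith_flowField (hK : IsInteractionKernel K L) (hμ : Integrable id μ) :
    LipschitzWith (Real.toNNReal (L * (1 + ∫ ζ, (1 + ‖ζ‖) ∂μ))) (flowField hK hμ) := by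
  set m := ∫ ζ, (1 + ‖ζ‖) ∂μ with hm'
  have hm : 0 ≤ m := integral_nonneg fun ζ => by positivity
  have hL := hK.nonneg
  refine LipschitzWith.of_dist_le_mul fun u v => ?_
  rw [Real.coe_toNNReal _ (by positivity), dist_eq_norm, dist_eq_norm,
    BoundedContinuousFunction.norm_le (by positivity)]
  intro ζ
  have h0 : 0 < 1 + ‖ζ‖ := by positivity
  have h1 := hK.norm_velocity_sub_le (integrable_unweight hμ u) (integrable_unweight hμ v)
    (unweight u ζ) (unweight v ζ)
  have h2 := integral_norm_unweight_comp_le (g := id) hμ (u - v)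
  have h3 := norm_unweight_le (u - v) ζ
  simp only [id, unweight_sub] at h2 h3
  have h4 : ‖unweight (flowField hK hμ u - flowField hK hμ v) ζ‖ ≤
      (1 + ‖ζ‖) * (L * (1 + m) * ‖u - v‖) := by
    rw [unweight_sub, unweight_flowField, unweight_flowField]
    have h5 : L * (m * ‖u - v‖) ≤ (1 + ‖ζ‖) * (L * (m * ‖u - v‖)) :=
      le_mul_of_one_le_left (by positivity) (by simp)
    calc _ ≤ L * ((1 + ‖ζ‖) * ‖u - v‖) + L * (m * ‖u - v‖) := by
            refine h1.trans ?_; gcongr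
        _ ≤ L * ((1 + ‖ζ‖) * ‖u - v‖) + (1 + ‖ζ‖) * (L * (m * ‖u - v‖)) := by
            gcongr
        _ = _ := by ring
  rw [unweight, norm_smul, Real.norm_of_nonneg h0.le] at h4
  exact le_of_mul_le_mul_left h4 h0

/-- The bounded continuous function representing the identity. -/
def weightedId (d : ℕ) : Phase d →ᵇ Phase d :=
  BoundedContinuousFunction.ofNormedAddCommGroup (fun ζ => (1 + ‖ζ‖)⁻¹ • ζ)
    (Continuous.smul (Continuous.inv₀ (f := fun ζ : Phase d => 1 + ‖ζ‖) (by fun_prop)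
      fun ζ => by positivity) continuous_id) 1
    (fun ζ => by
      have h0 : 0 < 1 + ‖ζ‖ := by positivity
      rw [norm_smul, norm_inv, Real.norm_of_nonneg h0.le, inv_mul_le_iff₀ h0]
      linarith)

theorem unweight_weightedId (ζ : Phase d) : unweight (weightedId d) ζ = ζ := by
  have h0 : 1 + ‖ζ‖ ≠ 0 := by positivity
  simp [unweight, weightedId, smul_smul, mul_inv_cancel₀ h0]

/-- `u` represents the mean field characteristic flow issued from `μ`. -/
structure IsCharacteristicFlow (hK : IsInteractionKernel K L) (hμ : Integrable id μ)
    (u : ℝ → Phase d →ᵇ Phase d) : Prop where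
  zero : u 0 = weightedId d
  hasDerivAt : ∀ t, HasDerivAt u (flowField hK hμ (u t)) t

theorem exists_isCharacteristicFlow (hK : IsInteractionKernel K L) (hμ : Integrable id μ) :
    ∃ u, IsCharacteristicFlow hK hμ u := by
  obtain ⟨u, h0, hu⟩ := exists_global_solution (fun _ => lipschitzWith_flowField hK hμ)
    (fun _ => continuous_const) 0 (weightedId d)
  exact ⟨u, h0, hu⟩

variable {hK : IsInteractionKernel K L} {hμ : Integrable id μ} {u : ℝ → Phase d →ᵇ Phase d}

theorem IsCharacteristicFlow.continuous (hu : IsCharacteristicFlow hK hμ u) : Continuous u :=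
  continuous_iff_continuousAt.2 fun t => (hu.hasDerivAt t).continuousAt

/-- Once `u` is known the nonlocal velocity can be frozen, and the characteristics are the ordinary
flow of a prescribed time-dependent field. -/
theorem IsCharacteristicFlow.isFlow (hu : IsCharacteristicFlow hK hμ u) :
    IsFlow (fun t => velocity K μ (unweight (u t))) (fun t => unweight (u t)) where
  zero x := by rw [hu.zero, unweight_weightedId]
  hasDerivAt x t := by
    rw [← unweight_flowField hK hμ]
    exact ((BoundedContinuousFunction.evalCLM ℝ x).hasFDerivAt.comp_hasDerivAt t
      (hu.hasDerivAt t)).const_smul (1 + ‖x‖)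

/-- Differentiation and continuity under the integral: differentials of `K` are dominated by `L`,
and `K` itself by an affine function of `‖ζ‖` because `‖u t‖` is locally bounded. -/
theorem IsCharacteristicFlow.isC1Field (hu : IsCharacteristicFlow hK hμ u) :
    IsC1Field (fun t => velocity K μ (unweight (u t)))
      (fun t z => ∫ ζ, fderiv ℝ (fun z => K z (unweight (u t) ζ)) z ∂μ) L.toNNReal where
  hasFDerivAt t z := by
    have hm : ∀ z, AEStronglyMeasurable
        (fun ζ => fderiv ℝ (fun z => K z (unweight (u t) ζ)) z) μ := fun z =>
      (hK.continuous_fderiv_left.comp (f := fun ζ => (z, unweight (u t) ζ))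
        (continuous_const.prodMk (continuous_unweight _))).aestronglyMeasurable
    exact hasFDerivAt_integral_of_dominated_of_fderiv_le (bound := fun _ => L)
      (F := fun z ζ => K z (unweight (u t) ζ))
      (F' := fun z ζ => fderiv ℝ (fun z => K z (unweight (u t) ζ)) z) (s := Set.univ) univ_mem
      (Eventually.of_forall fun z => (hK.integrable_comp (integrable_unweight hμ _) z).1)
      (hK.integrable_comp (integrable_unweight hμ _) z) (hm z)
      (Eventually.of_forall fun ζ z _ => hK.bound_left _ _) (integrable_const _)
      (Eventually.of_forall fun ζ z _ => hK.hasFDerivAt_left z (unweight (u t) ζ))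
  continuous := by
    refine continuous_iff_continuousAt.2 fun ⟨t₀, z₀⟩ => ?_
    have hc := hu.continuous
    refine continuousAt_of_dominated (bound := fun ζ => L * (‖z₀‖ + 1 + (1 + ‖ζ‖) * (‖u t₀‖ + 1)))
      (F := fun (p : ℝ × Phase d) ζ => K p.2 (unweight (u p.1) ζ))
      (Eventually.of_forall fun p => (hK.integrable_comp (integrable_unweight hμ _) _).1) ?_ ?_
      (Eventually.of_forall fun ζ => ?_)
    · have h1 : Continuous fun p : ℝ × Phase d => ‖p.2‖ := by fun_prop
      have h2 : Continuous fun p : ℝ × Phase d => ‖u p.1‖ := by fun_prop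
      filter_upwards [(h1.tendsto (t₀, z₀)).eventually_le_const (lt_add_one _),
        (h2.tendsto (t₀, z₀)).eventually_le_const (lt_add_one _)] with p hp1 hp2
      refine Eventually.of_forall fun ζ => (hK.norm_le _ _).trans ?_
      have := norm_unweight_le (u p.1) ζ
      have hL := hK.nonneg
      gcongr
      exact this.trans (by gcongr)
    · exact ((integrable_const _).add (((integrable_const 1).add hμ.norm).mul_const _)).const_mul _
    · have h3 : Continuous fun p : ℝ × Phase d => (p.2, unweight (u p.1) ζ) := by
        unfold unweight
        have h4 : Continuous fun p : ℝ × Phase d => u p.1 ζ :=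
          (BoundedContinuousFunction.evalCLM ℝ ζ).continuous.comp (hc.comp continuous_fst)
        fun_prop
      exact (hK.continuous.comp h3).continuousAt
  continuous_fderiv := by
    have hc := hu.continuous
    refine continuous_of_dominated (bound := fun ζ => L)
      (F := fun (p : ℝ × Phase d) ζ => fderiv ℝ (fun z => K z (unweight (u p.1) ζ)) p.2)
      (fun p => (hK.continuous_fderiv_left.comp (f := fun ζ => (p.2, unweight (u p.1) ζ))
        (continuous_const.prodMk (continuous_unweight _))).aestronglyMeasurable)
      (fun p => Eventually.of_forall fun ζ => hK.bound_left _ _) (integrable_const _)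
      (Eventually.of_forall fun ζ => ?_)
    have h3 : Continuous fun p : ℝ × Phase d => (p.2, unweight (u p.1) ζ) := by
      unfold unweight
      have h4 : Continuous fun p : ℝ × Phase d => u p.1 ζ :=
        (BoundedContinuousFunction.evalCLM ℝ ζ).continuous.comp (hc.comp continuous_fst)
      fun_prop
    exact hK.continuous_fderiv_left.comp h3
  bound t z := by
    refine (norm_integral_le_of_norm_le_const (C := L)
      (Eventually.of_forall fun ζ => hK.bound_left _ _)).trans ?_
    simp [hK.nonneg]

end WeightedSpace

/-! ### Dobrushin's stability estimate and weak convergence -/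

section Dobrushin

variable {d : ℕ} {K : Phase d → Phase d → Phase d} {L : ℝ}

/-- The continuous linear map sending a flow map of linear growth to its composition with an
integrable random variable. -/
def unweightL1 {Ω : Type*} [MeasurableSpace Ω] {π : Measure Ω} [IsFiniteMeasure π]
    {g : Ω → Phase d} (hg : Integrable g π) : (Phase d →ᵇ Phase d) →L[ℝ] (Ω →₁[π] Phase d) :=
  LinearMap.mkContinuous
    { toFun := fun u => (integrable_unweight_comp hg u).toL1 _
      map_add' := fun u v => by
        rw [← Integrable.toL1_add]
        congr 1
        funext ω
        simp [unweight]
      map_smul' := fun c u => by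
        rw [RingHom.id_apply, ← Integrable.toL1_smul]
        congr 1
        funext ω
        exact smul_comm (1 + ‖g ω‖) c (u (g ω)) }
    (∫ ω, (1 + ‖g ω‖) ∂π) (fun u => by
      simp only [LinearMap.coe_mk, AddHom.coe_mk]
      rw [L1.norm_of_fun_eq_integral_norm]
      exact integral_norm_unweight_comp_le hg u)

theorem unweightL1_apply {Ω : Type*} [MeasurableSpace Ω] {π : Measure Ω} [IsFiniteMeasure π]
    {g : Ω → Phase d} (hg : Integrable g π) (u : Phase d →ᵇ Phase d) :
    unweightL1 hg u = (integrable_unweight_comp hg u).toL1 _ := rfl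

variable {μ ν : Measure (Phase d)}

theorem IsCoupling.isProbabilityMeasure [IsProbabilityMeasure μ] {π : Measure (Phase d × Phase d)}
    (hπ : IsCoupling μ ν π) : IsProbabilityMeasure π :=
  ⟨by rw [← Set.preimage_univ (f := Prod.fst), ← Measure.map_apply measurable_fst .univ, hπ.1,
    measure_univ]⟩

theorem IsCoupling.integrable_fst {π : Measure (Phase d × Phase d)} (hπ : IsCoupling μ ν π)
    (hμ : Integrable id μ) : Integrable Prod.fst π := by
  rw [← hπ.1] at hμ
  exact hμ.comp_measurable measurable_fst

theorem IsCoupling.integrable_snd {π : Measure (Phase d × Phase d)} (hπ : IsCoupling μ ν π)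
    (hν : Integrable id ν) : Integrable Prod.snd π := by
  rw [← hπ.2] at hν
  exact hν.comp_measurable measurable_snd

variable [IsProbabilityMeasure μ] [IsProbabilityMeasure ν]

theorem velocity_map {Ω : Type*} [MeasurableSpace Ω] {π : Measure Ω} {g : Ω → Phase d}
    (hK : IsInteractionKernel K L)
    (hg : Measurable g) (u : Phase d →ᵇ Phase d) (z : Phase d) :
    velocity K (π.map g) (unweight u) z = velocity K π (fun ω => unweight u (g ω)) z := by
  have : Continuous fun ζ => K z (unweight u ζ) :=
    hK.continuous.comp (continuous_const.prodMk (continuous_unweight u))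
  exact integral_map hg.aemeasurable this.aestronglyMeasurable

variable {hK : IsInteractionKernel K L} {hμ : Integrable id μ} {hν : Integrable id ν}
  {u v : ℝ → Phase d →ᵇ Phase d}

/-- Dobrushin's estimate for a given coupling. -/
theorem integral_norm_sub_le_of_coupling (hu : IsCharacteristicFlow hK hμ u)
    (hv : IsCharacteristicFlow hK hν v) {π : Measure (Phase d × Phase d)}
    (hπ : IsCoupling μ ν π) (t : ℝ) :
    ∫ p, ‖unweight (u t) p.1 - unweight (v t) p.2‖ ∂π ≤
      Real.exp (2 * L * |t|) * ∫ p, ‖p.1 - p.2‖ ∂π := by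
  have := hπ.isProbabilityMeasure
  have h1 := hπ.integrable_fst hμ
  have h2 := hπ.integrable_snd hν
  have hi : ∀ a b : Phase d →ᵇ Phase d,
      Integrable (fun p : Phase d × Phase d => unweight a p.1 - unweight b p.2) π := fun a b =>
    (integrable_unweight_comp h1 a).sub (integrable_unweight_comp h2 b)
  have hn : ∀ a b : Phase d →ᵇ Phase d, ‖unweightL1 h1 a - unweightL1 h2 b‖ =
      ∫ p, ‖unweight a p.1 - unweight b p.2‖ ∂π := fun a b => by
    rw [unweightL1_apply, unweightL1_apply, ← Integrable.toL1_sub,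
      L1.norm_of_fun_eq_integral_norm]
    rfl
  -- The transport cost of the coupling carried by the two flows is the norm of a differentiable
  -- curve in `L¹(π)`, so Grönwall applies without differentiating the cost.
  have hd : ∀ t, HasDerivAt (fun t => unweightL1 h1 (u t) - unweightL1 h2 (v t))
      (unweightL1 h1 (flowField hK hμ (u t)) - unweightL1 h2 (flowField hK hν (v t))) t := fun t =>
    ((unweightL1 h1).hasFDerivAt.comp_hasDerivAt t (hu.hasDerivAt t)).sub
      ((unweightL1 h2).hasFDerivAt.comp_hasDerivAt t (hv.hasDerivAt t))
  have key := norm_le_exp_mul_of_norm_deriv_le (K := 2 * L) 0 hd (fun t => by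
    rw [hn, hn]
    -- By the marginal conditions both velocities become integrals against the same `π`, and their
    -- integrands can be compared pointwise.
    have e1 : ∀ z, velocity K μ (unweight (u t)) z =
        velocity K π (fun p => unweight (u t) p.1) z := fun z => by
      rw [← velocity_map hK measurable_fst, hπ.1]
    have e2 : ∀ z, velocity K ν (unweight (v t)) z =
        velocity K π (fun p => unweight (v t) p.2) z := fun z => by
      rw [← velocity_map hK measurable_snd, hπ.2]
    set I := ∫ p, ‖unweight (u t) p.1 - unweight (v t) p.2‖ ∂π with hI
    calc ∫ p, ‖unweight (flowField hK hμ (u t)) p.1 - unweight (flowField hK hν (v t)) p.2‖ ∂π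
        ≤ ∫ p, (L * ‖unweight (u t) p.1 - unweight (v t) p.2‖ + L * I) ∂π := by
          refine integral_mono (hi _ _).norm (((hi _ _).norm.const_mul L).add
            (integrable_const _)) fun p => ?_
          simp only [unweight_flowField, e1, e2]
          exact hK.norm_velocity_sub_le (integrable_unweight_comp h1 _)
            (integrable_unweight_comp h2 _) _ _
      _ = 2 * L * I := by
          rw [integral_add ((hi _ _).norm.const_mul L) (integrable_const _), integral_const_mul]
          simp; ring) t
  rw [hn, hn, sub_zero, hu.zero, hv.zero] at key
  simpa only [unweight_weightedId] using key

theorem lintegral_edist_eq {Ω : Type*} [MeasurableSpace Ω] {π : Measure Ω} {f g : Ω → Phase d}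
    (h : Integrable (fun ω => f ω - g ω) π) :
    ∫⁻ ω, edist (f ω) (g ω) ∂π = ENNReal.ofReal (∫ ω, ‖f ω - g ω‖ ∂π) := by
  rw [ofReal_integral_norm_eq_lintegral_enorm h]
  simp_rw [edist_eq_enorm_sub]

/-- Dobrushin's stability estimate in Monge-Kantorovich distance. -/
theorem distMK_map_le (hu : IsCharacteristicFlow hK hμ u)
    (hv : IsCharacteristicFlow hK hν v) (t : ℝ) :
    distMK (μ.map (unweight (u t))) (ν.map (unweight (v t))) ≤
      ENNReal.ofReal (Real.exp (2 * L * |t|)) * distMK μ ν := by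
  have hc0 : ENNReal.ofReal (Real.exp (2 * L * |t|)) ≠ 0 := by
    simpa using Real.exp_pos _
  rw [distMK, distMK, ENNReal.mul_iInf_of_ne hc0 ENNReal.ofReal_ne_top]
  refine le_iInf fun π => ?_
  rw [ENNReal.mul_iInf_of_ne hc0 ENNReal.ofReal_ne_top]
  refine le_iInf fun hπ => ?_
  have := hπ.isProbabilityMeasure
  have h1 := hπ.integrable_fst hμ
  have h2 := hπ.integrable_snd hν
  have mu : Measurable (unweight (u t)) := (continuous_unweight _).measurable
  have mv : Measurable (unweight (v t)) := (continuous_unweight _).measurable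
  have mG : Measurable (Prod.map (unweight (u t)) (unweight (v t))) := mu.prodMap mv
  -- The competitor at time `t` is the initial coupling pushed forward by the product of the flows;
  -- no optimal coupling is needed.
  refine (iInf₂_le (π.map (Prod.map (unweight (u t)) (unweight (v t)))) ⟨?_, ?_⟩).trans ?_
  · rw [lintegral_map (measurable_fst.edist measurable_snd) mG]
    simp only [Prod.map_fst, Prod.map_snd]
    rw [lintegral_edist_eq ((integrable_unweight_comp h1 _).sub (integrable_unweight_comp h2 _)),
      lintegral_edist_eq (h1.sub h2), ← ENNReal.ofReal_mul (Real.exp_pos _).le]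
    exact ENNReal.ofReal_le_ofReal (integral_norm_sub_le_of_coupling hu hv hπ t)
  · rw [← hπ.1, Measure.map_map measurable_fst mG, Measure.map_map mu measurable_fst]
    rfl
  · rw [← hπ.2, Measure.map_map measurable_snd mG, Measure.map_map mv measurable_snd]
    rfl

/-- The easy half of Kantorovich-Rubinstein duality: under any coupling the difference of the
integrals is the integral of `φ(x) - φ(y)`. The case `C = 0` is separate because a zero factor need
not pass through the infimum in `[0, ∞]`. -/
theorem enorm_integral_sub_le_distMK {φ : Phase d → ℝ} {C : NNReal} (hφ : LipschitzWith C φ)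
    {B : ℝ} (hB : ∀ z, |φ z| ≤ B) :
    ‖∫ z, φ z ∂μ - ∫ z, φ z ∂ν‖ₑ ≤ C * distMK μ ν := by
  by_cases hC : C = 0
  · subst hC
    have h : ∀ z, φ z = φ 0 := fun z => by
      have := hφ.dist_le_mul z 0
      simpa using this
    simp_rw [h]
    simp
  rw [distMK, ENNReal.mul_iInf_of_ne (by simpa using hC) ENNReal.coe_ne_top]
  refine le_iInf fun π => ?_
  rw [ENNReal.mul_iInf_of_ne (by simpa using hC) ENNReal.coe_ne_top]
  refine le_iInf fun hπ => ?_
  have := hπ.isProbabilityMeasure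
  have hm := hφ.continuous.measurable
  have hi : ∀ {g : Phase d × Phase d → Phase d}, Measurable g →
      Integrable (fun p => φ (g p)) π := fun hg =>
    Integrable.of_bound (hm.comp hg).aestronglyMeasurable B (Eventually.of_forall fun p => hB _)
  rw [← hπ.1, ← hπ.2, integral_map measurable_fst.aemeasurable hm.aestronglyMeasurable,
    integral_map measurable_snd.aemeasurable hm.aestronglyMeasurable,
    ← integral_sub (hi measurable_fst) (hi measurable_snd),
    ← lintegral_const_mul _ (by fun_prop)]
  refine (enorm_integral_le_lintegral_enorm _).trans (lintegral_mono fun p => ?_)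
  rw [← edist_eq_enorm_sub]
  exact hφ _ _

/-- Convergence in Monge-Kantorovich distance implies weak convergence. -/
theorem tendsto_integral_of_tendsto_distMK {m : ℕ → Measure (Phase d)}
    (hm : ∀ N, IsProbabilityMeasure (m N))
    (h : Tendsto (fun N => distMK (m N) ν) atTop (𝓝 0)) (φ : Phase d →ᵇ ℝ) :
    Tendsto (fun N => ∫ z, φ z ∂(m N)) atTop (𝓝 (∫ z, φ z ∂ν)) := by
  let P : ℕ → ProbabilityMeasure (Phase d) := fun N => ⟨m N, hm N⟩
  let Q : ProbabilityMeasure (Phase d) := ⟨ν, inferInstance⟩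
  have key : Tendsto P atTop (𝓝 Q) := by
    -- Bounded Lipschitz functions suffice to test weak convergence of probability measures.
    refine tendsto_iff_forall_lipschitz_integral_tendsto.2 ?_
    rintro f ⟨C, hC⟩ ⟨M, hM⟩
    have hB : ∀ z, |f z| ≤ C + |f 0| := fun z => by
      have := hC z 0
      rw [Real.dist_eq] at this
      have := abs_sub_abs_le_abs_sub (f z) (f 0)
      linarith
    rw [tendsto_iff_edist_tendsto_0]
    have h0 : Tendsto (fun N => (M : ℝ≥0∞) * distMK (m N) ν) atTop (𝓝 0) := by
      simpa using ENNReal.Tendsto.const_mul h (Or.inr ENNReal.coe_ne_top)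
    refine tendsto_of_tendsto_of_tendsto_of_le_of_le tendsto_const_nhds h0
      (fun _ => zero_le) fun N => ?_
    have := hm N
    rw [edist_eq_enorm_sub]
    exact enorm_integral_sub_le_distMK hM hB
  exact (ProbabilityMeasure.tendsto_iff_forall_integral_tendsto.1 key) φ

end Dobrushin

/-! ### Empirical measures and the N-particle system -/

section Particles

variable {d N : ℕ} {K : Phase d → Phase d → Phase d} {L : ℝ}

theorem isProbabilityMeasure_empirical (hN : 1 ≤ N) (z : Fin N → Phase d) :
    IsProbabilityMeasure (empirical z) := ⟨by
  have h0 : (N : ℝ≥0∞) ≠ 0 := by simp; omega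
  simp [empirical, ENNReal.inv_mul_cancel h0 (ENNReal.natCast_ne_top N)]⟩

theorem integral_empirical {F : Type*} [NormedAddCommGroup F] [NormedSpace ℝ F] [CompleteSpace F]
    (z : Fin N → Phase d) (g : Phase d → F) :
    ∫ x, g x ∂(empirical z) = (N : ℝ)⁻¹ • ∑ j, g (z j) := by
  rw [empirical, integral_smul_measure,
    integral_finsetSum_measure fun i _ => integrable_dirac (by simp)]
  simp

theorem integrable_id_empirical (hN : 1 ≤ N) (z : Fin N → Phase d) :
    Integrable id (empirical z) := by
  have h0 : (N : ℝ≥0∞) ≠ 0 := by simp; omega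
  refine Integrable.smul_measure ?_ (ENNReal.inv_ne_top.2 h0)
  exact integrable_finsetSum_measure.2 fun i _ => integrable_dirac (by simp)

theorem map_empirical {X : Phase d → Phase d} (hX : Measurable X) (z : Fin N → Phase d) :
    (empirical z).map X = empirical fun i => X (z i) := by
  simp only [empirical, Measure.map_smul, Measure.map_finset_sum hX.aemeasurable,
    Measure.map_dirac' hX]

/-- The particle vector field is `2L`-Lipschitz for the sup norm over particles, since the factor
`1/N` compensates the sum. -/
theorem IsParticleSolution.unique (hK : IsInteractionKernel K L) {z : Fin N → Phase d}
    {Z W : ℝ → Fin N → Phase d} (hZ : IsParticleSolution K z Z) (hW : IsParticleSolution K z W) :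
    Z = W := by
  have hL := hK.nonneg
  refine ODE_solution_unique_univ (t₀ := 0) (s := fun _ => Set.univ) (K := (2 * L).toNNReal)
    (v := fun _ Z i => (N : ℝ)⁻¹ • ∑ j, K (Z i) (Z j)) (fun t => ?_)
    (fun t => ⟨hasDerivAt_pi.2 (hZ.2 t), trivial⟩)
    (fun t => ⟨hasDerivAt_pi.2 (hW.2 t), trivial⟩) (hZ.1.trans hW.1.symm)
  refine (LipschitzWith.of_dist_le_mul fun x y => ?_).lipschitzOnWith
  rw [Real.coe_toNNReal _ (by positivity), dist_eq_norm, pi_norm_le_iff_of_nonneg (by positivity)]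
  intro i
  have hN : (0 : ℝ) < N := by
    have := i.pos
    exact_mod_cast this
  rw [Pi.sub_apply, ← smul_sub, ← Finset.sum_sub_distrib, norm_smul, norm_inv,
    Real.norm_of_nonneg hN.le, inv_mul_le_iff₀ hN]
  refine (norm_sum_le_of_le _ (f := fun j => K (x i) (x j) - K (y i) (y j))
    (n := fun j => 2 * L * dist x y) fun j _ => ?_).trans (by simp)
  have h1 : ‖x i - y i‖ ≤ dist x y := by rw [← dist_eq_norm]; exact dist_le_pi_dist x y i
  have h2 : ‖x j - y j‖ ≤ dist x y := by rw [← dist_eq_norm]; exact dist_le_pi_dist x y j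
  have := hK.norm_sub_le (x i) (x j) (y i) (y j)
  nlinarith

/-- The velocity generated by an empirical measure is exactly the particle sum. This gives existence
for the particle system and lets Dobrushin's estimate compare particles with the continuum. -/
theorem IsCharacteristicFlow.isParticleSolution {z : Fin N → Phase d}
    {hK : IsInteractionKernel K L} [IsProbabilityMeasure (empirical z)]
    {hμ : Integrable id (empirical z)} {u : ℝ → Phase d →ᵇ Phase d}
    (hu : IsCharacteristicFlow hK hμ u) :
    IsParticleSolution K z fun t i => unweight (u t) (z i) :=
  ⟨funext fun i => hu.isFlow.zero _, fun t i => by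
    have := hu.isFlow.hasDerivAt (z i) t
    rwa [velocity, integral_empirical] at this⟩

end Particles

/-! ### Transport of densities by the flow, and its continuity in L¹ -/

section Transport

variable {d : ℕ} {V : ℝ → Phase d → Phase d} {A : ℝ → Phase d → Phase d →L[ℝ] Phase d}
  {L : NNReal} {Z Y : ℝ → Phase d → Phase d}

/-- The density of the image of `ρ dx` under the inverse of the map `y`. -/
def transport (y : Phase d → Phase d) (ρ : Phase d → ℝ) (x : Phase d) : ℝ :=
  |(fderiv ℝ y x).det| * ρ (y x)

theorem IsInverseFlow.contDiff_slice (hY : IsInverseFlow Z Y) (hZ : IsFlow V Z)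
    (hV : IsC1Field V A L) (t : ℝ) : ContDiff ℝ 1 (Y t) :=
  (hY.contDiff hZ hV).comp (f := fun x => (t, x)) (by fun_prop)

theorem IsInverseFlow.injective (hY : IsInverseFlow Z Y) (t : ℝ) : Function.Injective (Y t) :=
  Function.LeftInverse.injective (g := Z t) (hY.right_inv t)

theorem IsInverseFlow.surjective (hY : IsInverseFlow Z Y) (t : ℝ) : Function.Surjective (Y t) :=
  Function.RightInverse.surjective (g := Z t) (hY.left_inv t)

theorem IsInverseFlow.hasFDerivAt (hY : IsInverseFlow Z Y) (hZ : IsFlow V Z)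
    (hV : IsC1Field V A L) (t : ℝ) (x : Phase d) : HasFDerivAt (Y t) (fderiv ℝ (Y t) x) x :=
  ((hY.contDiff_slice hZ hV t).differentiable one_ne_zero x).hasFDerivAt

variable {F : Type*} [NormedAddCommGroup F] [NormedSpace ℝ F]

theorem integral_det_smul (hY : IsInverseFlow Z Y) (hZ : IsFlow V Z)
    (hV : IsC1Field V A L) (t : ℝ) (g : Phase d → F) :
    ∫ x, |(fderiv ℝ (Y t) x).det| • g (Y t x) = ∫ x, g x := by
  have := integral_image_eq_integral_abs_det_fderiv_smul volume (s := Set.univ) .univ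
    (fun x _ => (hY.hasFDerivAt hZ hV t x).hasFDerivWithinAt) (hY.injective t).injOn g
  rw [Set.image_univ, (hY.surjective t).range_eq] at this
  simpa using this.symm

theorem integrable_det_smul (hY : IsInverseFlow Z Y) (hZ : IsFlow V Z)
    (hV : IsC1Field V A L) (t : ℝ) {g : Phase d → F} (hg : Integrable g) :
    Integrable fun x => |(fderiv ℝ (Y t) x).det| • g (Y t x) := by
  have := integrableOn_image_iff_integrableOn_abs_det_fderiv_smul volume (s := Set.univ) .univ
    (fun x _ => (hY.hasFDerivAt hZ hV t x).hasFDerivWithinAt) (hY.injective t).injOn g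
  rw [Set.image_univ, (hY.surjective t).range_eq, integrableOn_univ, integrableOn_univ] at this
  exact this.1 hg

theorem integrable_transport (hY : IsInverseFlow Z Y) (hZ : IsFlow V Z)
    (hV : IsC1Field V A L) (t : ℝ) {ρ : Phase d → ℝ} (hρ : Integrable ρ) :
    Integrable (transport (Y t) ρ) := integrable_det_smul hY hZ hV t hρ

theorem integral_transport_smul (hY : IsInverseFlow Z Y) (hZ : IsFlow V Z)
    (hV : IsC1Field V A L) (t : ℝ) (ρ : Phase d → ℝ) (g : Phase d → F) :
    ∫ x, transport (Y t) ρ x • g x = ∫ x, ρ x • g (Z t x) := by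
  rw [← integral_det_smul hY hZ hV t fun x => ρ x • g (Z t x)]
  simp only [transport, hY.right_inv, smul_smul]

theorem integrable_transport_smul (hY : IsInverseFlow Z Y) (hZ : IsFlow V Z)
    (hV : IsC1Field V A L) (t : ℝ) {ρ : Phase d → ℝ} {g : Phase d → F}
    (h : Integrable fun x => ρ x • g (Z t x)) :
    Integrable fun x => transport (Y t) ρ x • g x := by
  have := integrable_det_smul hY hZ hV t h
  simpa only [transport, hY.right_inv, smul_smul] using this

/-- Transport is an `L¹` isometry, whatever the time; a.e. equality is therefore preserved and
approximation errors stay uniform in time. -/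
theorem integral_norm_transport_sub (hY : IsInverseFlow Z Y) (hZ : IsFlow V Z)
    (hV : IsC1Field V A L) (t : ℝ) (ρ σ : Phase d → ℝ) :
    ∫ x, ‖transport (Y t) ρ x - transport (Y t) σ x‖ = ∫ x, ‖ρ x - σ x‖ := by
  rw [← integral_det_smul hY hZ hV t fun x => ‖ρ x - σ x‖]
  refine integral_congr_ae (Eventually.of_forall fun x => ?_)
  simp [transport, ← mul_sub]

theorem transport_congr_ae (hY : IsInverseFlow Z Y) (hZ : IsFlow V Z)
    (hV : IsC1Field V A L) (t : ℝ) {ρ σ : Phase d → ℝ} (hρ : Integrable ρ) (hσ : Integrable σ)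
    (h : ρ =ᵐ[volume] σ) : transport (Y t) ρ =ᵐ[volume] transport (Y t) σ := by
  have h1 : ∫ x, ‖transport (Y t) ρ x - transport (Y t) σ x‖ = 0 := by
    rw [integral_norm_transport_sub hY hZ hV]
    refine integral_eq_zero_of_ae ?_
    filter_upwards [h] with x hx
    simp [hx]
  have h2 := (integral_eq_zero_iff_of_nonneg (fun x => norm_nonneg _)
    ((integrable_transport hY hZ hV t hρ).sub (integrable_transport hY hZ hV t hσ)).norm).1 h1
  filter_upwards [h2] with x hx
  exact sub_eq_zero.1 (norm_eq_zero.1 hx)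

theorem IsProbDensity.transport (hY : IsInverseFlow Z Y) (hZ : IsFlow V Z)
    (hV : IsC1Field V A L) (t : ℝ) {ρ : Phase d → ℝ} (hρ : IsProbDensity ρ) :
    IsProbDensity (transport (Y t) ρ) where
  integrable := integrable_transport hY hZ hV t hρ.integrable
  nonneg := by
    -- Nonnegativity is only known a.e.; replacing `ρ` by `|ρ|`, which does not change the transport
    -- a.e., avoids discussing null sets under the flow.
    have h : ρ =ᵐ[volume] fun x => |ρ x| := by
      filter_upwards [hρ.nonneg] with x hx
      rw [abs_of_nonneg hx]
    filter_upwards [transport_congr_ae hY hZ hV t hρ.integrable hρ.integrable.abs h] with x hx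
    rw [hx]
    exact mul_nonneg (abs_nonneg _) (abs_nonneg _)
  integral_eq_one := by
    rw [← hρ.integral_eq_one]
    exact integral_det_smul hY hZ hV t ρ

theorem densityMeasure_transport (hY : IsInverseFlow Z Y) (hZ : IsFlow V Z)
    (hV : IsC1Field V A L) (t : ℝ) (ρ : Phase d → ℝ) :
    densityMeasure (transport (Y t) ρ) = (densityMeasure ρ).map (Z t) := by
  have hm : Measurable (Z t) :=
    ((hZ.continuous hV).comp (f := fun x => (t, x)) (by fun_prop)).measurable
  ext B hB
  rw [Measure.map_apply hm hB, densityMeasure, densityMeasure, withDensity_apply _ hB,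
    withDensity_apply _ (hm hB)]
  have h : Z t ⁻¹' B = Y t '' B := by
    ext x
    constructor
    · intro hx; exact ⟨Z t x, hx, hY.left_inv t x⟩
    · rintro ⟨y, hy, rfl⟩; simpa [hY.right_inv] using hy
  rw [h, lintegral_image_eq_lintegral_abs_det_fderiv_mul volume hB
    (fun x _ => (hY.hasFDerivAt hZ hV t x).hasFDerivWithinAt) (hY.injective t).injOn]
  simp only [transport, ENNReal.ofReal_mul (abs_nonneg _)]

theorem continuous_transport (hY : IsInverseFlow Z Y) (hZ : IsFlow V Z)
    (hV : IsC1Field V A L) {ρ : Phase d → ℝ} (hρ : Continuous ρ) :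
    Continuous fun p : ℝ × Phase d => transport (Y p.1) ρ p.2 := by
  have h : ∀ p : ℝ × Phase d, fderiv ℝ (Y p.1) p.2 =
      (fderiv ℝ (fun p : ℝ × Phase d => Y p.1 p.2) p).comp
        (ContinuousLinearMap.inr ℝ ℝ (Phase d)) := fun p =>
    (HasFDerivAt.comp (g := fun p : ℝ × Phase d => Y p.1 p.2) (f := fun x => (p.1, x)) p.2
      ((hY.contDiff hZ hV).differentiable one_ne_zero (p.1, p.2)).hasFDerivAt
      (hasFDerivAt_prodMk_right p.1 p.2)).fderiv
  simp only [transport, h]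
  have h1 : Continuous fun p : ℝ × Phase d =>
      ((fderiv ℝ (fun p : ℝ × Phase d => Y p.1 p.2) p).comp
        (ContinuousLinearMap.inr ℝ ℝ (Phase d))).det :=
    ContinuousLinearMap.continuous_det.comp
      (((hY.contDiff hZ hV).continuous_fderiv one_ne_zero).clm_comp continuous_const)
  exact h1.abs.mul (hρ.comp (hY.continuous hZ hV))

/-- For times in `[s-1, s+1]` all transported densities vanish off one compact set, the image of
`[s-1, s+1] × supp ρ` under the flow, so joint continuity gives convergence of the integrals. -/
theorem tendsto_integral_norm_transport_sub_of_compactSupport (hY : IsInverseFlow Z Y)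
    (hZ : IsFlow V Z) (hV : IsC1Field V A L) {ρ : Phase d → ℝ} (hρ : Continuous ρ)
    (hρ' : HasCompactSupport ρ) (s : ℝ) :
    Tendsto (fun t => ∫ x, ‖transport (Y t) ρ x - transport (Y s) ρ x‖) (𝓝 s) (𝓝 0) := by
  have hc := continuous_transport hY hZ hV hρ
  have hs : s ∈ Set.Ioo (s - 1) (s + 1) := ⟨by linarith, by linarith⟩
  have key := continuousOn_integral_of_compact_support (μ := (volume : Measure (Phase d)))
    (f := fun t x => ‖transport (Y t) ρ x - transport (Y s) ρ x‖) (s := Set.Icc (s - 1) (s + 1))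
    (k := (fun p : ℝ × Phase d => Z p.1 p.2) '' (Set.Icc (s - 1) (s + 1) ×ˢ tsupport ρ))
    ((isCompact_Icc.prod hρ').image (hZ.continuous hV))
    (Continuous.continuousOn (hc.sub
      (hc.comp (f := fun p : ℝ × Phase d => (s, p.2)) (by fun_prop))).norm) ?_
  · have := (key.continuousAt (Icc_mem_nhds hs.1 hs.2)).tendsto
    simpa using this
  · intro t x ht hx
    have h0 : ∀ r ∈ Set.Icc (s - 1) (s + 1), transport (Y r) ρ x = 0 := fun r hr => by
      have : ρ (Y r x) = 0 := by
        by_contra hne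
        exact hx ⟨(r, Y r x), ⟨hr, subset_tsupport _ hne⟩, hY.right_inv r x⟩
      simp [transport, this]
    simp [h0 t ht, h0 s ⟨hs.1.le, hs.2.le⟩]

/-- Approximate `ρ` in `L¹` by a continuous compactly supported `σ`; the isometry property makes
both approximation errors independent of time, leaving three terms of at most `ε/4`. -/
theorem continuous_toL1_transport (hY : IsInverseFlow Z Y)
    (hZ : IsFlow V Z) (hV : IsC1Field V A L) {ρ : Phase d → ℝ} (hρ : Integrable ρ) :
    Continuous fun t => (integrable_transport hY hZ hV t hρ).toL1 (transport (Y t) ρ) := by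
  refine continuous_iff_continuousAt.2 fun s => ?_
  rw [ContinuousAt, Metric.tendsto_nhds]
  intro ε hε
  obtain ⟨σ, hσ, hσ', hσc, hσi⟩ := hρ.exists_hasCompactSupport_integral_sub_le
    (ε := ε / 4) (by positivity)
  filter_upwards [(tendsto_integral_norm_transport_sub_of_compactSupport hY hZ hV hσc hσ
    s).eventually_lt_const (show (0 : ℝ) < ε / 4 by positivity)] with t ht
  have i1 := fun r => integrable_transport hY hZ hV r hρ
  have i2 := fun r => integrable_transport hY hZ hV r hσi
  have j1 : Integrable fun x => ‖transport (Y t) ρ x - transport (Y t) σ x‖ :=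
    ((i1 t).sub (i2 t)).norm
  have j2 : Integrable fun x => ‖transport (Y t) σ x - transport (Y s) σ x‖ :=
    ((i2 t).sub (i2 s)).norm
  have j3 : Integrable fun x => ‖transport (Y s) ρ x - transport (Y s) σ x‖ :=
    ((i1 s).sub (i2 s)).norm
  have j12 : Integrable fun x => ‖transport (Y t) ρ x - transport (Y t) σ x‖ +
    ‖transport (Y t) σ x - transport (Y s) σ x‖ := j1.add j2
  rw [dist_eq_norm, ← Integrable.toL1_sub, L1.norm_of_fun_eq_integral_norm]
  calc ∫ x, ‖(transport (Y t) ρ - transport (Y s) ρ) x‖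
      ≤ ∫ x, (‖transport (Y t) ρ x - transport (Y t) σ x‖ +
          ‖transport (Y t) σ x - transport (Y s) σ x‖ +
          ‖transport (Y s) ρ x - transport (Y s) σ x‖) := by
        refine integral_mono ((i1 t).sub (i1 s)).norm (j12.add j3) fun x => ?_
        simp only [Pi.sub_apply, Real.norm_eq_abs]
        grind
    _ = (∫ x, ‖ρ x - σ x‖) + (∫ x, ‖transport (Y t) σ x - transport (Y s) σ x‖) +
          ∫ x, ‖ρ x - σ x‖ := by
        rw [integral_add j12 j3, integral_add j1 j2, integral_norm_transport_sub hY hZ hV,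
          integral_norm_transport_sub hY hZ hV]
    _ < ε := by linarith

end Transport

/-! ### Probability densities as measures -/

section Density

variable {d : ℕ} {ρ : Phase d → ℝ} {F : Type*} [NormedAddCommGroup F] [NormedSpace ℝ F]

theorem IsProbDensity.integral_densityMeasure (hρ : IsProbDensity ρ) (g : Phase d → F) :
    ∫ z, g z ∂(densityMeasure ρ) = ∫ z, ρ z • g z := by
  rw [densityMeasure, integral_withDensity_eq_integral_toReal_smul₀
    hρ.integrable.1.aemeasurable.ennreal_ofReal (Eventually.of_forall fun _ => ENNReal.ofReal_lt_top)]
  refine integral_congr_ae ?_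
  filter_upwards [hρ.nonneg] with z hz
  rw [ENNReal.toReal_ofReal hz]

theorem IsProbDensity.integrable_densityMeasure_iff (hρ : IsProbDensity ρ) {g : Phase d → F} :
    Integrable g (densityMeasure ρ) ↔ Integrable fun z => ρ z • g z := by
  rw [densityMeasure, integrable_withDensity_iff_integrable_smul₀'
    hρ.integrable.1.aemeasurable.ennreal_ofReal (Eventually.of_forall fun _ => ENNReal.ofReal_lt_top)]
  refine integrable_congr ?_
  filter_upwards [hρ.nonneg] with z hz
  rw [ENNReal.toReal_ofReal hz]

theorem IsProbDensity.isProbabilityMeasure (hρ : IsProbDensity ρ) :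
    IsProbabilityMeasure (densityMeasure ρ) := ⟨by
  rw [densityMeasure, withDensity_apply _ .univ, Measure.restrict_univ,
    ← ofReal_integral_eq_lintegral_ofReal hρ.integrable hρ.nonneg, hρ.integral_eq_one,
    ENNReal.ofReal_one]⟩

theorem HasFiniteFirstMoment.integrable_id (hm : HasFiniteFirstMoment ρ) (hρ : IsProbDensity ρ) :
    Integrable id (densityMeasure ρ) := by
  rw [← integrable_norm_iff (by fun_prop), hρ.integrable_densityMeasure_iff]
  simpa [HasFiniteFirstMoment, mul_comm] using hm

end Density

/-! ### Existence of a weak solution -/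

section Existence

variable {d : ℕ} {K : Phase d → Phase d → Phase d} {L : ℝ} {ρ : Phase d → ℝ}
  [IsProbabilityMeasure (densityMeasure ρ)]
  {hK : IsInteractionKernel K L} {hμ : Integrable id (densityMeasure ρ)}
  {u : ℝ → Phase d →ᵇ Phase d} {Y : ℝ → Phase d → Phase d}

/-- The transported density as a curve in `L¹`. -/
def densityCurve (hu : IsCharacteristicFlow hK hμ u)
    (hY : IsInverseFlow (fun t => unweight (u t)) Y) (hρ : IsProbDensity ρ) (t : ℝ) :
    Lp ℝ 1 (volume : Measure (Phase d)) :=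
  (integrable_transport hY hu.isFlow hu.isC1Field t hρ.integrable).toL1 _

variable {hu : IsCharacteristicFlow hK hμ u} {hY : IsInverseFlow (fun t => unweight (u t)) Y}
  {hρ : IsProbDensity ρ}

theorem coeFn_densityCurve (t : ℝ) :
    densityCurve hu hY hρ t =ᵐ[volume] transport (Y t) ρ := Integrable.coeFn_toL1 _

theorem isProbDensity_densityCurve (t : ℝ) : IsProbDensity (densityCurve hu hY hρ t) := by
  have h := hρ.transport hY hu.isFlow hu.isC1Field t
  have he := coeFn_densityCurve (hu := hu) (hY := hY) (hρ := hρ) t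
  refine ⟨L1.integrable_coeFn _, ?_, ?_⟩
  · filter_upwards [he, h.nonneg] with x h1 h2
    rwa [h1]
  · rw [integral_congr_ae he, h.integral_eq_one]

theorem densityMeasure_densityCurve (t : ℝ) :
    densityMeasure (densityCurve hu hY hρ t) = (densityMeasure ρ).map (unweight (u t)) := by
  rw [← densityMeasure_transport hY hu.isFlow hu.isC1Field, densityMeasure, densityMeasure]
  refine withDensity_congr_ae ?_
  filter_upwards [coeFn_densityCurve (hu := hu) (hY := hY) (hρ := hρ) t] with x hx
  rw [hx]

theorem integral_densityCurve_smul {F : Type*} [NormedAddCommGroup F] [NormedSpace ℝ F]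
    (t : ℝ) (g : Phase d → F) :
    ∫ x, densityCurve hu hY hρ t x • g x = ∫ x, g (unweight (u t) x) ∂(densityMeasure ρ) := by
  rw [hρ.integral_densityMeasure, ← integral_transport_smul hY hu.isFlow hu.isC1Field]
  refine integral_congr_ae ?_
  filter_upwards [coeFn_densityCurve (hu := hu) (hY := hY) (hρ := hρ) t] with x hx
  rw [hx]

/-- Self-consistency: the field whose flow transports the density is the mean-field velocity of the
transported density. -/
theorem meanVelocity_densityCurve (t : ℝ) (z : Phase d) :
    meanVelocity K (densityCurve hu hY hρ t) z =
      velocity K (densityMeasure ρ) (unweight (u t)) z :=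
  integral_densityCurve_smul t (K z)

/-- Differentiation under the integral; the speed of the characteristic from `ζ` is at most
`(1+‖ζ‖)` times a locally bounded factor, integrable by the first moment. -/
theorem hasDerivAt_integral_comp_flow (hu : IsCharacteristicFlow hK hμ u) {φ : Phase d → ℝ}
    (hφ : IsC1b φ) (t : ℝ) :
    HasDerivAt (fun s => ∫ ζ, φ (unweight (u s) ζ) ∂(densityMeasure ρ))
      (∫ ζ, fderiv ℝ φ (unweight (u t) ζ) (velocity K (densityMeasure ρ) (unweight (u t))
        (unweight (u t) ζ)) ∂(densityMeasure ρ)) t := by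
  obtain ⟨B, hB⟩ := hφ.bounded
  obtain ⟨C, hC⟩ := hφ.fderiv_bounded
  have hC0 : 0 ≤ C := (norm_nonneg _).trans (hC 0)
  have hc : Continuous fun s => ‖flowField hK hμ (u s)‖ :=
    ((lipschitzWith_flowField hK hμ).continuous.comp hu.continuous).norm
  have hev := (hc.tendsto t).eventually_lt_const (lt_add_one _)
  have hcont : ∀ s, Continuous fun ζ => φ (unweight (u s) ζ) := fun s =>
    hφ.contDiff.continuous.comp (continuous_unweight _)
  refine (hasDerivAt_integral_of_dominated_loc_of_deriv_le
    (F := fun s ζ => φ (unweight (u s) ζ))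
    (F' := fun s ζ => fderiv ℝ φ (unweight (u s) ζ) (velocity K (densityMeasure ρ) (unweight (u s))
        (unweight (u s) ζ)))
    (bound := fun ζ => C * ((1 + ‖ζ‖) * (‖flowField hK hμ (u t)‖ + 1))) hev
    (Eventually.of_forall fun s => (hcont s).aestronglyMeasurable)
    (Integrable.of_bound (hcont t).aestronglyMeasurable B (Eventually.of_forall fun ζ => hB _))
    ?_ (Eventually.of_forall fun ζ s hs => ?_)
    ((((integrable_const 1).add hμ.norm).mul_const _).const_mul C)
    (Eventually.of_forall fun ζ s _ => ?_)).2
  · simp_rw [← unweight_flowField hK hμ]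
    exact (((hφ.contDiff.continuous_fderiv one_ne_zero).comp (continuous_unweight _)).clm_apply
      (continuous_unweight _)).aestronglyMeasurable
  · rw [← unweight_flowField hK hμ]
    refine (ContinuousLinearMap.le_of_opNorm_le _ (hC _) _).trans ?_
    have := norm_unweight_le (flowField hK hμ (u s)) ζ
    have hs' : ‖flowField hK hμ (u s)‖ ≤ ‖flowField hK hμ (u t)‖ + 1 := le_of_lt hs
    gcongr
    exact this.trans (by gcongr)
  · exact (hφ.contDiff.differentiable one_ne_zero _).hasFDerivAt.comp_hasDerivAt s
      (hu.isFlow.hasDerivAt ζ s)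

theorem isWeakSolution_densityCurve : IsWeakSolution K ρ (densityCurve hu hY hρ) where
  continuous := continuous_toL1_transport hY hu.isFlow hu.isC1Field hρ.integrable
  moment t := by
    have h : Integrable (fun x => ‖unweight (u t) x‖) (densityMeasure ρ) :=
      (integrable_unweight hμ (u t)).norm
    have := integrable_transport_smul hY hu.isFlow hu.isC1Field t (g := fun x => ‖x‖)
      (hρ.integrable_densityMeasure_iff.1 h)
    refine this.congr ?_
    filter_upwards [coeFn_densityCurve (hu := hu) (hY := hY) (hρ := hρ) t] with x hx
    rw [hx, smul_eq_mul, mul_comm]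
  init := by
    refine (coeFn_densityCurve 0).trans (Eventually.of_forall fun x => ?_)
    have h : Y 0 = id := funext fun x => by
      have := hY.left_inv 0 x
      rwa [hu.isFlow.zero] at this
    simp [transport, h, ContinuousLinearMap.det]
  weak_eq φ hφ t := by
    have h1 : ∀ (s : ℝ) (g : Phase d → ℝ), ∫ z, g z * densityCurve hu hY hρ s z =
        ∫ x, g (unweight (u s) x) ∂(densityMeasure ρ) := fun s g => by
      rw [← integral_densityCurve_smul (hu := hu) (hY := hY) (hρ := hρ)]
      simp only [smul_eq_mul, mul_comm]
    simp_rw [h1, meanVelocity_densityCurve]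
    exact hasDerivAt_integral_comp_flow hu hφ t

end Existence

/-! ### From a conditional Grönwall inequality to vanishing, by Baire category -/

section SelfImproving

/-- A function `D` satisfies a self-improving growth estimate on `[-T, T]`: an a priori bound `c`
for `D` on the interval between `s` and `t` improves to a bound by `D s`, up to a small multiple
of `c`. -/
structure IsSelfImproving (D : ℝ → ℝ) (E M T : ℝ) : Prop where
  nonneg : ∀ t, 0 ≤ D t
  isClosed : ∀ c, IsClosed {t | D t ≤ c}
  growth : ∀ s ∈ Set.Icc (-T) T, ∀ t ∈ Set.Icc (-T) T, ∀ c, (∀ r ∈ Set.uIcc s t, D r ≤ c) →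
    D t ≤ E * D s + M * c * |t - s|
  E_nonneg : 0 ≤ E
  M_nonneg : 0 ≤ M

variable {D : ℝ → ℝ} {E M T : ℝ}

/-- On a short interval the growth estimate applied with the supremum `S` reads `S ≤ E D(s) + S/2`.
The a priori bound `c` only serves to make `S` finite and drops out of the conclusion. -/
theorem IsSelfImproving.le_of_bounded (h : IsSelfImproving D E M T) {s t c : ℝ}
    (hs : s ∈ Set.Icc (-T) T) (ht : t ∈ Set.Icc (-T) T) (hc : ∀ r ∈ Set.uIcc s t, D r ≤ c)
    (hst : |t - s| ≤ 1 / (2 * (M + 1))) {r : ℝ} (hr : r ∈ Set.uIcc s t) : D r ≤ 2 * E * D s := by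
  have hM := h.M_nonneg
  set S := sSup (D '' Set.uIcc s t) with hS
  have hb : BddAbove (D '' Set.uIcc s t) := ⟨c, by rintro _ ⟨r, hr, rfl⟩; exact hc r hr⟩
  have hle : ∀ r ∈ Set.uIcc s t, D r ≤ S := fun r hr => le_csSup hb ⟨r, hr, rfl⟩
  have hS0 : 0 ≤ S := (h.nonneg s).trans (hle s Set.left_mem_uIcc)
  have key : S ≤ E * D s + S / 2 := by
    refine csSup_le ⟨_, s, Set.left_mem_uIcc, rfl⟩ ?_
    rintro _ ⟨r, hr, rfl⟩
    have hsub : Set.uIcc s r ⊆ Set.uIcc s t := Set.uIcc_subset_uIcc_left hr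
    have h1 := h.growth s hs r (Set.uIcc_subset_Icc hs ht hr) S fun q hq => hle q (hsub hq)
    have h2 : |r - s| ≤ 1 / (2 * (M + 1)) := (Set.abs_sub_left_of_mem_uIcc hr).trans hst
    have h3 : M * S * |r - s| ≤ (M + 1) * S * (1 / (2 * (M + 1))) := by gcongr; linarith
    have h4 : (M + 1) * S * (1 / (2 * (M + 1))) = S / 2 := by field_simp
    linarith
  have := hle r hr
  linarith

theorem IsSelfImproving.bounded_of_forall_locally {K : Set ℝ} (hK : IsCompact K)
    {I : Set ℝ} (hg : ∀ t ∈ K, ∃ c, ∀ᶠ r in 𝓝 t, r ∈ I → D r ≤ c) :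
    ∃ c, ∀ r ∈ K, r ∈ I → D r ≤ c := by
  refine hK.induction_on (p := fun s => ∃ c, ∀ r ∈ s, r ∈ I → D r ≤ c) ⟨0, by simp⟩ ?_ ?_ ?_
  · rintro s t hst ⟨c, hc⟩; exact ⟨c, fun r hr => hc r (hst hr)⟩
  · rintro s t ⟨c, hc⟩ ⟨c', hc'⟩
    refine ⟨max c c', fun r hr hI => ?_⟩
    rcases hr with hr | hr
    · exact (hc r hr hI).trans (le_max_left _ _)
    · exact (hc' r hr hI).trans (le_max_right _ _)
  · intro t ht
    obtain ⟨c, hc⟩ := hg t ht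
    exact ⟨_, mem_nhdsWithin_of_mem_nhds hc, c, fun r hr => hr⟩

/-- Let `B` be the closed set of times near which `D` is unbounded. If `B` is nonempty, Baire gives
`t₀ ∈ B` near which `D` is bounded on `B`; the self-improving estimate extends this bound across the
gaps of `B`, contradicting `t₀ ∈ B`. -/
theorem IsSelfImproving.locally_bounded (h : IsSelfImproving D E M T) :
    ∀ t ∈ Set.Icc (-T) T, ∃ c, ∀ᶠ r in 𝓝 t, r ∈ Set.Icc (-T) T → D r ≤ c := by
  set I := Set.Icc (-T) T with hI
  by_contra! hcon
  obtain ⟨a, haI, ha⟩ := hcon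
  let G : Set ℝ := {t | ∃ c, ∀ᶠ r in 𝓝 t, r ∈ I → D r ≤ c}
  have hGo : IsOpen G := isOpen_iff_mem_nhds.2 fun t ⟨c, hc⟩ => by
    filter_upwards [hc.eventually_nhds] with r hr
    exact ⟨c, hr⟩
  let B : Set ℝ := I ∩ Gᶜ
  have hB : IsClosed B := isClosed_Icc.inter hGo.isClosed_compl
  have haB : a ∈ B := ⟨haI, fun ⟨c, hc⟩ => ha c (hc.mono fun r hr => by simpa using hr)⟩
  have : CompleteSpace B := hB.completeSpace_coe
  have : Nonempty B := ⟨⟨a, haB⟩⟩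
  -- The closed sets `{D ≤ n}` cover the complete space `B` because `D` is finite everywhere.
  obtain ⟨n, ⟨t₀, ht₀⟩, hint⟩ := nonempty_interior_of_iUnion_of_closed
    (f := fun n : ℕ => {b : B | D b ≤ n})
    (fun n => (h.isClosed n).preimage continuous_subtype_val)
    (by
      refine Set.eq_univ_of_forall fun b => ?_
      obtain ⟨n, hn⟩ := exists_nat_ge (D b)
      exact Set.mem_iUnion.2 ⟨n, hn⟩)
  obtain ⟨η, hη, hball⟩ := Metric.mem_nhds_iff.1 (mem_interior_iff_mem_nhds.1 hint)
  have hbd : ∀ b ∈ B, |b - t₀| < η → D b ≤ n := fun b hb hbt =>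
    hball (show (⟨b, hb⟩ : B) ∈ Metric.ball ⟨t₀, ht₀⟩ η from by
      rw [Metric.mem_ball, Subtype.dist_eq, Real.dist_eq]; exact hbt)
  have hM := h.M_nonneg
  have hE := h.E_nonneg
  have hδ : 0 < 1 / (2 * (M + 1)) := by positivity
  set δ := 1 / (2 * (M + 1)) with hδ'
  refine ht₀.2 ⟨max n (2 * E * n), ?_⟩
  filter_upwards [Metric.ball_mem_nhds t₀ (lt_min hη hδ)] with r hr hrI
  rw [Metric.mem_ball, Real.dist_eq, lt_min_iff] at hr
  by_cases hrB : r ∈ B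
  · exact (hbd r hrB hr.1).trans (le_max_left _ _)
  -- `β` is the first point of `B` met when going from `r` towards `t₀`; between `r` and `β`, the
  -- point `β` excluded, `D` is locally bounded.
  obtain ⟨β, ⟨hβB, hβ⟩, hmin⟩ := (isCompact_uIcc.inter_left hB).exists_isMinOn
    (s := B ∩ Set.uIcc r t₀) ⟨t₀, ht₀, Set.right_mem_uIcc⟩
    (f := fun x => |x - r|) (by fun_prop)
  have hβt : |β - t₀| ≤ |r - t₀| := by
    rw [abs_sub_comm β, abs_sub_comm r]; exact Set.abs_sub_right_of_mem_uIcc hβ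
  have hβr : |r - β| ≤ |r - t₀| := by
    rw [abs_sub_comm r β, abs_sub_comm r]; exact Set.abs_sub_left_of_mem_uIcc hβ
  have hDβ : D β ≤ n := hbd β hβB (hβt.trans_lt hr.1)
  have hfree : ∀ x ∈ Set.uIcc r β, x ≠ β → x ∈ G := fun x hx hxβ => by
    by_contra hxG
    have hxI : x ∈ I := Set.uIcc_subset_Icc hrI hβB.1 hx
    have h1 : |β - r| ≤ |x - r| := hmin ⟨⟨hxI, hxG⟩, Set.uIcc_subset_uIcc_left hβ hx⟩
    have h2 := Set.mem_uIcc.1 hx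
    apply hxβ
    rcases h2 with h2 | h2
    · rw [abs_of_nonneg (by linarith), abs_of_nonneg (by linarith)] at h1; linarith
    · rw [abs_of_nonpos (by linarith), abs_of_nonpos (by linarith)] at h1; linarith
  -- Starting at `r`, the improved bound on `[r, x]` does not degenerate as `x` approaches `β`, so
  -- `D` is bounded on the closed gap. The estimate is then run from `β`, giving a bound that no
  -- longer involves `D r`.
  have hbound : ∀ x ∈ Set.uIcc β r, D x ≤ max (2 * E * D r) n := fun x hx => by
    rw [Set.uIcc_comm] at hx
    by_cases hxβ : x = β
    · rw [hxβ]; exact hDβ.trans (le_max_right _ _)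
    have hxI : x ∈ I := Set.uIcc_subset_Icc hrI hβB.1 hx
    have hne : ∀ y ∈ Set.uIcc r x, y ∈ G := fun y hy => by
      refine hfree y (Set.uIcc_subset_uIcc_left hx hy) ?_
      rintro rfl
      have h1 := Set.abs_sub_left_of_mem_uIcc hy
      have h2 := Set.mem_uIcc.1 hx
      apply hxβ
      rcases h2 with h2 | h2
      · rw [abs_of_nonneg (by linarith), abs_of_nonneg (by linarith)] at h1; linarith
      · rw [abs_of_nonpos (by linarith), abs_of_nonpos (by linarith)] at h1; linarith
    obtain ⟨c, hc⟩ := bounded_of_forall_locally isCompact_uIcc hne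
    refine (h.le_of_bounded hrI hxI (fun y hy => hc y hy (Set.uIcc_subset_Icc hrI hxI hy)) ?_
      Set.right_mem_uIcc).trans (le_max_left _ _)
    refine (Set.abs_sub_left_of_mem_uIcc hx).trans ?_
    rw [abs_sub_comm]
    exact hβr.trans hr.2.le
  refine (h.le_of_bounded hβB.1 hrI hbound (hβr.trans hr.2.le) Set.right_mem_uIcc).trans ?_
  exact le_trans (by gcongr) (le_max_right _ _)

theorem IsSelfImproving.eq_zero (h : IsSelfImproving D E M T) (h0 : D 0 = 0) :
    ∀ t ∈ Set.Icc (-T) T, D t = 0 := by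
  obtain ⟨c, hc⟩ := IsSelfImproving.bounded_of_forall_locally isCompact_Icc h.locally_bounded
  have hM := h.M_nonneg
  have hδ : 0 < 1 / (2 * (M + 1)) := by positivity
  have key : ∀ n : ℕ, ∀ t ∈ Set.Icc (-T) T, |t| ≤ n * (1 / (2 * (M + 1))) → D t = 0 := by
    intro n
    induction n with
    | zero =>
      intro t _ ht
      have : t = 0 := by simpa using ht
      rw [this, h0]
    | succ n ih =>
      intro t htI ht
      -- Scaling `t` towards `0` treats both signs at once: `s` satisfies the induction hypothesis
      -- and lies within one admissible step of `t`.
      set s := (n / (n + 1) : ℝ) * t with hs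
      have hn : (0 : ℝ) ≤ n := n.cast_nonneg
      have hle : (n / (n + 1) : ℝ) ≤ 1 := (div_le_one (by positivity)).2 (by linarith)
      push_cast at ht
      have hs1 : |s| ≤ n * (1 / (2 * (M + 1))) := by
        rw [hs, abs_mul, abs_of_nonneg (by positivity : (0 : ℝ) ≤ n / (n + 1))]
        calc _ ≤ (n / (n + 1) : ℝ) * ((n + 1) * (1 / (2 * (M + 1)))) := by gcongr
          _ = _ := by field_simp
      have hs2 : |t - s| ≤ 1 / (2 * (M + 1)) := by
        have : t - s = (1 / (n + 1) : ℝ) * t := by rw [hs]; field_simp; ring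
        rw [this, abs_mul, abs_of_nonneg (by positivity : (0 : ℝ) ≤ 1 / (n + 1))]
        calc _ ≤ (1 / (n + 1) : ℝ) * ((n + 1) * (1 / (2 * (M + 1)))) := by gcongr
          _ = _ := by field_simp
      have hsI : s ∈ Set.Icc (-T) T := by
        have h1 : |s| ≤ |t| := by
          rw [hs, abs_mul, abs_of_nonneg (by positivity : (0 : ℝ) ≤ n / (n + 1))]
          exact mul_le_of_le_one_left (abs_nonneg _) hle
        exact abs_le.1 (h1.trans (abs_le.2 htI))
      have := h.le_of_bounded hsI htI (fun r hr =>
        hc r (Set.uIcc_subset_Icc hsI htI hr) (Set.uIcc_subset_Icc hsI htI hr)) hs2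
        Set.right_mem_uIcc
      rw [ih s hsI hs1, mul_zero] at this
      exact le_antisymm this (h.nonneg t)
  intro t ht
  obtain ⟨n, hn⟩ := exists_nat_ge (|t| / (1 / (2 * (M + 1))))
  exact key n t ht ((div_le_iff₀ hδ).1 hn)

end SelfImproving

/-! ### Pairing L¹ curves with time-dependent test functions -/

section Pairing

variable {d : ℕ}

theorem integrable_mul_L1 {φ : Phase d → ℝ} (hφ : Continuous φ) {B : ℝ} (hB : ∀ z, |φ z| ≤ B)
    (g : Lp ℝ 1 (volume : Measure (Phase d))) : Integrable fun z => φ z * g z :=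
  (L1.integrable_coeFn g).bdd_mul hφ.aestronglyMeasurable (Eventually.of_forall hB)

theorem abs_integral_mul_L1_le {φ : Phase d → ℝ} {B : ℝ} (hB : ∀ z, |φ z| ≤ B)
    (g : Lp ℝ 1 (volume : Measure (Phase d))) : |∫ z, φ z * g z| ≤ B * ‖g‖ := by
  rw [L1.norm_eq_integral_norm, ← integral_const_mul, ← Real.norm_eq_abs]
  refine norm_integral_le_of_norm_le ((L1.integrable_coeFn g).norm.const_mul B)
    (Eventually.of_forall fun z => ?_)
  rw [norm_mul]
  exact mul_le_mul_of_nonneg_right (hB z) (norm_nonneg _)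

theorem integral_mul_L1_sub {φ : Phase d → ℝ} (hφ : Continuous φ) {B : ℝ} (hB : ∀ z, |φ z| ≤ B)
    (g h : Lp ℝ 1 (volume : Measure (Phase d))) :
    ∫ z, φ z * (g - h : Lp ℝ 1 (volume : Measure (Phase d))) z =
      (∫ z, φ z * g z) - ∫ z, φ z * h z := by
  rw [← integral_sub (integrable_mul_L1 hφ hB g) (integrable_mul_L1 hφ hB h)]
  refine integral_congr_ae ?_
  filter_upwards [Lp.coeFn_sub g h] with z hz
  rw [hz, Pi.sub_apply, mul_sub]

/-- Differentiability of the pairing of a `C¹` curve of compactly supported functions with a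
curve in `L¹`, when the latter is weakly differentiable. -/
theorem hasDerivAt_integral_mul_curve {θ : ℝ → Phase d → ℝ}
    (hθ : ContDiff ℝ 1 fun p : ℝ × Phase d => θ p.1 p.2) {k : Set (Phase d)} (hk : IsCompact k)
    {r₀ : ℝ} (hsupp : ∀ r ∈ Set.Icc (r₀ - 1) (r₀ + 1), ∀ x ∉ k, θ r x = 0)
    {g : ℝ → Lp ℝ 1 (volume : Measure (Phase d))} (hg : Continuous g) {D : ℝ}
    (hD : HasDerivAt (fun r => ∫ z, θ r₀ z * g r z) D r₀) :
    HasDerivAt (fun r => ∫ z, θ r z * g r z)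
      ((∫ z, fderiv ℝ (fun p : ℝ × Phase d => θ p.1 p.2) (r₀, z) (1, 0) * g r₀ z) + D) r₀ := by
  set P : ℝ → Phase d → ℝ := fun r z => fderiv ℝ (fun p : ℝ × Phase d => θ p.1 p.2) (r, z) (1, 0)
    with hP
  have hPc : Continuous fun p : ℝ × Phase d => P p.1 p.2 :=
    (hθ.continuous_fderiv one_ne_zero).clm_apply continuous_const
  have hPd : ∀ r z, HasDerivAt (fun r => θ r z) (P r z) r := fun r z =>
    HasFDerivAt.comp_hasDerivAt (f := fun r => (r, z)) r
      (hθ.differentiable one_ne_zero (r, z)).hasFDerivAt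
      ((hasDerivAt_id r).prodMk (hasDerivAt_const r z))
  have hI : ∀ r, |r - r₀| < 1 → r ∈ Set.Icc (r₀ - 1) (r₀ + 1) := fun r hr => by
    have := abs_lt.1 hr
    constructor <;> linarith
  have hP0 : ∀ r, |r - r₀| < 1 → ∀ x ∉ k, P r x = 0 := fun r hr x hx => by
    have h1 : (fun r => θ r x) =ᶠ[𝓝 r] fun _ => 0 := by
      have : Metric.ball r₀ 1 ∈ 𝓝 r := Metric.isOpen_ball.mem_nhds (by simpa [Real.dist_eq])
      filter_upwards [this] with s hs
      exact hsupp s (hI s (by simpa [Real.dist_eq] using hs)) x hx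
    exact (hPd r x).unique ((hasDerivAt_const r (0 : ℝ)).congr_of_eventuallyEq h1)
  have hPs : Continuous (P r₀) := hPc.comp (f := fun x => (r₀, x)) (by fun_prop)
  have hθs : ∀ r, Continuous (θ r) := fun r => hθ.continuous.comp (f := fun x => (r, x)) (by fun_prop)
  have hbd : ∀ {ψ : Phase d → ℝ}, Continuous ψ → (∀ x ∉ k, ψ x = 0) → ∃ B, ∀ x, |ψ x| ≤ B := by
    intro ψ hψ h0
    obtain ⟨B, hB⟩ := hk.exists_bound_of_continuousOn hψ.continuousOn
    refine ⟨max B 0, fun x => ?_⟩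
    by_cases hx : x ∈ k
    · exact (hB x hx).trans (le_max_left _ _)
    · simp [h0 x hx]
  obtain ⟨B, hB⟩ := hbd hPs (hP0 r₀ (by simp))
  obtain ⟨B₀, hB₀⟩ := hbd (hθs r₀) (hsupp r₀ (hI r₀ (by simp)))
  have hB0 : 0 ≤ B := (abs_nonneg _).trans (hB 0)
  -- As `g` is merely continuous in `L¹`, its variation is only seen through the fixed function `θ
  -- r₀`, where `hD` applies; the other term carries the time derivative of `θ`.
  have hsplit : (fun r => ∫ z, θ r z * g r z) =ᶠ[𝓝 r₀]
      fun r => (∫ z, (θ r z - θ r₀ z) * g r z) + ∫ z, θ r₀ z * g r z := by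
    filter_upwards [Metric.ball_mem_nhds r₀ one_pos] with r hr
    rw [Metric.mem_ball, Real.dist_eq] at hr
    obtain ⟨B₁, hB₁⟩ := hbd (hθs r) (hsupp r (hI r hr))
    simp_rw [sub_mul]
    rw [integral_sub (integrable_mul_L1 (hθs r) hB₁ _) (integrable_mul_L1 (hθs r₀) hB₀ _),
      sub_add_cancel]
  refine HasDerivAt.congr_of_eventuallyEq (HasDerivAt.add ?_ hD) hsplit
  rw [hasDerivAt_iff_isLittleO, Asymptotics.isLittleO_iff]
  intro ε hε
  have hg1 : ∀ᶠ r in 𝓝 r₀, ‖g r‖ ≤ ‖g r₀‖ + 1 :=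
    (hg.norm.tendsto r₀).eventually_le_const (lt_add_one _)
  have hg2 : ∀ᶠ r in 𝓝 r₀, ‖g r - g r₀‖ ≤ ε / 2 / (B + 1) := by
    have : Continuous fun r => ‖g r - g r₀‖ := by fun_prop
    exact (this.tendsto r₀).eventually_le_const (by simp; positivity)
  set ω := ε / 2 / (‖g r₀‖ + 1) with hω
  have hω0 : 0 < ω := by positivity
  have hunif : ∀ᶠ r in 𝓝 r₀, ∀ x ∈ k, ‖P r x - P r₀ x‖ ≤ ω := by
    refine hk.eventually_forall_of_forall_eventually fun x _ => ?_
    have hc : Continuous fun p : ℝ × Phase d => ‖P p.1 p.2 - P r₀ p.2‖ :=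
      (hPc.sub (hPs.comp continuous_snd)).norm
    have := hc.tendsto (r₀, x)
    simp only [sub_self, norm_zero] at this
    exact this.eventually_le_const hω0
  obtain ⟨δ, hδ, hδu⟩ := Metric.eventually_nhds_iff_ball.1 hunif
  filter_upwards [hg1, hg2, Metric.ball_mem_nhds r₀ (lt_min hδ one_pos)] with r h1 h2 hr
  rw [Metric.mem_ball, lt_min_iff] at hr
  have hr1 : |r - r₀| < 1 := by rw [← Real.dist_eq]; exact hr.2
  -- The mean value inequality in time with the modulus of `P` uniform on `k`; off `k` everything
  -- vanishes.
  have hrem : ∀ x, |θ r x - θ r₀ x - (r - r₀) * P r₀ x| ≤ ω * |r - r₀| := fun x => by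
    by_cases hx : x ∈ k
    · have hm : ∀ s, HasDerivWithinAt (fun s => θ s x - (s - r₀) * P r₀ x) (P s x - P r₀ x)
          (Metric.ball r₀ δ) s := fun s => by
        simpa using ((hPd s x).fun_sub (((hasDerivAt_id s).sub_const r₀).mul_const
          (P r₀ x))).hasDerivWithinAt (s := Metric.ball r₀ δ)
      have := (convex_ball r₀ δ).norm_image_sub_le_of_norm_hasDerivWithin_le
        (fun s _ => hm s) (fun s hs => hδu s hs x hx) (Metric.mem_ball_self hδ)
        (show r ∈ Metric.ball r₀ δ from hr.1)
      simp only [sub_self, zero_mul, sub_zero, Real.norm_eq_abs] at this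
      convert this using 2
      ring
    · rw [hsupp r (hI r hr1) x hx, hsupp r₀ (hI r₀ (by simp)) x hx, hP0 r₀ (by simp) x hx]
      simp; positivity
  obtain ⟨B₁, hB₁⟩ := hbd (hθs r) (hsupp r (hI r hr1))
  have i1 : Integrable fun z => (θ r z - θ r₀ z) * g r z :=
    integrable_mul_L1 ((hθs r).sub (hθs r₀)) (B := B₁ + B₀)
      (fun z => (abs_sub _ _).trans (add_le_add (hB₁ z) (hB₀ z))) _
  have i2 := integrable_mul_L1 hPs hB (g r)
  have e1 : (∫ z, (θ r z - θ r₀ z) * g r z) - (r - r₀) * ∫ z, P r₀ z * g r₀ z =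
      (∫ z, (θ r z - θ r₀ z - (r - r₀) * P r₀ z) * g r z) +
        (r - r₀) * ∫ z, P r₀ z * (g r - g r₀ : Lp ℝ 1 (volume : Measure (Phase d))) z := by
    rw [integral_mul_L1_sub hPs hB]
    have : ∀ z, (θ r z - θ r₀ z - (r - r₀) * P r₀ z) * g r z =
        (θ r z - θ r₀ z) * g r z - (r - r₀) * (P r₀ z * g r z) := fun z => by ring
    simp_rw [this]
    rw [integral_sub i1 (i2.const_mul _), integral_const_mul]
    ring
  simp only [sub_self, zero_mul, integral_zero, sub_zero, smul_eq_mul]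
  rw [e1, Real.norm_eq_abs, Real.norm_eq_abs]
  refine (abs_add_le _ _).trans ?_
  rw [abs_mul]
  have b1 := abs_integral_mul_L1_le hrem (g r)
  have b2 := abs_integral_mul_L1_le hB (g r - g r₀)
  have b3 : ω * |r - r₀| * ‖g r‖ ≤ ε / 2 * |r - r₀| := by
    calc _ ≤ ω * |r - r₀| * (‖g r₀‖ + 1) := by gcongr
      _ = _ := by rw [hω]; field_simp
  have b4 : B * ‖g r - g r₀‖ ≤ ε / 2 := by
    calc _ ≤ (B + 1) * (ε / 2 / (B + 1)) := by gcongr; linarith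
      _ = _ := by field_simp
  have b5 := mul_le_mul_of_nonneg_left (b2.trans b4) (abs_nonneg (r - r₀))
  linarith

end Pairing

/-! ### The dual Lipschitz norm on zero-mass densities -/

section DualNorm

variable {d : ℕ}

/-- `C¹` functions with compact support and Lipschitz constant `M`. -/
structure IsTest (φ : Phase d → ℝ) (M : ℝ) : Prop where
  contDiff : ContDiff ℝ 1 φ
  compact : HasCompactSupport φ
  bound : ∀ x, ‖fderiv ℝ φ x‖ ≤ M

variable {φ : Phase d → ℝ} {M : ℝ}

theorem IsTest.bounded (h : IsTest φ M) : ∃ B, ∀ x, |φ x| ≤ B :=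
  h.compact.exists_bound_of_continuous h.contDiff.continuous

theorem IsTest.isC1b (h : IsTest φ M) : IsC1b φ := ⟨h.contDiff, h.bounded, M, h.bound⟩

theorem IsTest.smul (h : IsTest φ M) {c : ℝ} (hc : 0 ≤ c) : IsTest (fun x => c * φ x) (c * M) where
  contDiff := contDiff_const.mul h.contDiff
  compact := h.compact.mul_left
  bound x := by
    rw [fderiv_const_mul (h.contDiff.differentiable one_ne_zero x), norm_smul,
      Real.norm_of_nonneg hc]
    exact mul_le_mul_of_nonneg_left (h.bound x) hc

theorem isTest_zero : IsTest (fun _ : Phase d => 0) 1 :=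
  ⟨contDiff_const, HasCompactSupport.zero, fun x => by simp⟩

instance : Nonempty {φ : Phase d → ℝ // IsTest φ 1} := ⟨⟨_, isTest_zero⟩⟩

/-- The dual Lipschitz norm of a signed density. -/
def dualNorm (w : Lp ℝ 1 (volume : Measure (Phase d))) : ℝ :=
  ⨆ φ : {φ : Phase d → ℝ // IsTest φ 1}, |∫ z, φ.1 z * w z|

theorem dualNorm_nonneg (w : Lp ℝ 1 (volume : Measure (Phase d))) : 0 ≤ dualNorm w :=
  Real.iSup_nonneg fun _ => abs_nonneg _

variable {w : Lp ℝ 1 (volume : Measure (Phase d))}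

theorem norm_sub_zero_le_of_fderiv {F : Type*} [NormedAddCommGroup F] [NormedSpace ℝ F]
    {ψ : Phase d → F} (hψ : ContDiff ℝ 1 ψ) (hM : ∀ x, ‖fderiv ℝ ψ x‖ ≤ M) (x : Phase d) :
    ‖ψ x - ψ 0‖ ≤ M * ‖x‖ := by
  simpa using Convex.norm_image_sub_le_of_norm_fderiv_le (s := Set.univ)
    (fun z _ => hψ.differentiable one_ne_zero z) (fun z _ => hM z) convex_univ
    (Set.mem_univ (0 : Phase d)) (Set.mem_univ x)

theorem integrable_mul_of_growth (hm : HasFiniteFirstMoment w) {ψ : Phase d → ℝ}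
    (hψ : Continuous ψ) (h : ∀ x, |ψ x| ≤ M * ‖x‖) : Integrable fun z => ψ z * w z := by
  refine Integrable.mono' (hm.norm.const_mul M)
    (hψ.aestronglyMeasurable.mul (L1.integrable_coeFn w).1) (Eventually.of_forall fun z => ?_)
  rw [norm_mul, norm_mul, norm_norm, ← mul_assoc]
  exact mul_le_mul_of_nonneg_right (h z) (norm_nonneg _)

theorem abs_integral_mul_le_of_growth (hm : HasFiniteFirstMoment w) {ψ : Phase d → ℝ}
    (h : ∀ x, |ψ x| ≤ M * ‖x‖) : |∫ z, ψ z * w z| ≤ M * ∫ z, ‖‖z‖ * w z‖ := by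
  rw [← integral_const_mul, ← Real.norm_eq_abs]
  refine norm_integral_le_of_norm_le (hm.norm.const_mul M) (Eventually.of_forall fun z => ?_)
  rw [norm_mul, norm_mul, norm_norm, ← mul_assoc]
  exact mul_le_mul_of_nonneg_right (h z) (norm_nonneg _)

theorem IsTest.integral_sub_const (h : IsTest φ M) (h0 : ∫ z, w z = 0) :
    ∫ z, (φ z - φ 0) * w z = ∫ z, φ z * w z := by
  obtain ⟨B, hB⟩ := h.bounded
  simp_rw [sub_mul]
  rw [integral_sub (integrable_mul_L1 h.contDiff.continuous hB w)
    ((L1.integrable_coeFn w).const_mul _), integral_const_mul, h0, mul_zero, sub_zero]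

/-- Zero mass allows replacing `φ` by `φ - φ 0`, which is at most `‖x‖`, so the first moment bounds
every pairing. -/
theorem bddAbove_dualNorm (hm : HasFiniteFirstMoment w) (h0 : ∫ z, w z = 0) :
    BddAbove (Set.range fun φ : {φ : Phase d → ℝ // IsTest φ 1} => |∫ z, φ.1 z * w z|) := by
  refine ⟨1 * ∫ z, ‖‖z‖ * w z‖, ?_⟩
  rintro _ ⟨⟨φ, hφ⟩, rfl⟩
  change |∫ z, φ z * w z| ≤ _
  rw [← hφ.integral_sub_const h0]
  exact abs_integral_mul_le_of_growth hm (norm_sub_zero_le_of_fderiv hφ.contDiff hφ.bound)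

theorem IsTest.abs_integral_le (h : IsTest φ M) (hM : 0 < M) (hm : HasFiniteFirstMoment w)
    (h0 : ∫ z, w z = 0) : |∫ z, φ z * w z| ≤ M * dualNorm w := by
  have h1 : IsTest (fun x => M⁻¹ * φ x) 1 := by
    simpa [hM.ne'] using h.smul (inv_nonneg.2 hM.le)
  have h2 : |∫ z, M⁻¹ * φ z * w z| ≤ dualNorm w := le_ciSup (bddAbove_dualNorm hm h0) ⟨_, h1⟩
  simp_rw [mul_assoc] at h2
  rwa [integral_const_mul, abs_mul, abs_of_pos (inv_pos.2 hM), inv_mul_le_iff₀ hM] at h2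

/-- Dilates of one bump function: `‖x‖ ‖∇χ(x)‖` is scale invariant, hence bounded uniformly in `n`.
-/
theorem exists_cutoff (d : ℕ) : ∃ c : ℝ, 0 ≤ c ∧ ∃ χ : ℕ → Phase d → ℝ, ∀ n,
    ContDiff ℝ 1 (χ n) ∧ HasCompactSupport (χ n) ∧ (∀ x, |χ n x| ≤ 1) ∧
    (∀ x, ‖x‖ * ‖fderiv ℝ (χ n) x‖ ≤ c) ∧ ∀ x, ‖x‖ ≤ n → χ n x = 1 := by
  let b : ContDiffBump (0 : Phase d) := ⟨1, 2, one_pos, one_lt_two⟩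
  have hb : ContDiff ℝ 1 b := b.contDiff
  have hb' : HasCompactSupport fun x => ‖x‖ * ‖fderiv ℝ b x‖ :=
    (b.hasCompactSupport.fderiv ℝ).norm.mul_left
  have hbc := hb.continuous_fderiv one_ne_zero
  obtain ⟨c, hc⟩ := hb'.exists_bound_of_continuous (by fun_prop)
  refine ⟨c, (norm_nonneg _).trans (hc 0), fun n x => b ((n + 1 : ℝ)⁻¹ • x), fun n => ?_⟩
  have hn : (0 : ℝ) < n + 1 := by positivity
  refine ⟨hb.comp (by fun_prop), ?_, fun x => ?_, fun x => ?_, fun x hx => ?_⟩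
  · exact b.hasCompactSupport.comp_smul (inv_ne_zero hn.ne')
  · rw [abs_of_nonneg b.nonneg]; exact b.le_one
  · have h1 : HasFDerivAt (fun x => b ((n + 1 : ℝ)⁻¹ • x)) ((fderiv ℝ b ((n + 1 : ℝ)⁻¹ • x)).comp
        ((n + 1 : ℝ)⁻¹ • ContinuousLinearMap.id ℝ (Phase d))) x :=
      HasFDerivAt.comp (g := b) (f := fun x => (n + 1 : ℝ)⁻¹ • x) x (hb.differentiable one_ne_zero _).hasFDerivAt
        (((n + 1 : ℝ)⁻¹ • ContinuousLinearMap.id ℝ (Phase d)).hasFDerivAt)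
    rw [h1.fderiv, ContinuousLinearMap.comp_smul, ContinuousLinearMap.comp_id, norm_smul,
      mul_left_comm, ← mul_assoc, ← norm_smul]
    exact (le_abs_self _).trans (hc _)
  · refine b.one_of_mem_closedBall ?_
    rw [mem_closedBall_zero_iff, norm_smul, norm_inv, Real.norm_of_nonneg hn.le,
      inv_mul_le_iff₀ hn]
    change ‖x‖ ≤ (n + 1) * 1
    linarith

/-- Removes compact support from the test functions. Since `|ψ| ≤ M‖x‖`, the scale-invariant cutoff
costs only `cM` in the gradient of `ψ χ_n`, and the first moment allows passing to the limit. -/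
theorem exists_abs_integral_le_dualNorm (d : ℕ) : ∃ C : ℝ, 0 ≤ C ∧
    ∀ w : Lp ℝ 1 (volume : Measure (Phase d)), HasFiniteFirstMoment w → ∫ z, w z = 0 →
    ∀ (ψ : Phase d → ℝ) (M : ℝ), 0 < M → ContDiff ℝ 1 ψ → (∀ x, ‖fderiv ℝ ψ x‖ ≤ M) → ψ 0 = 0 →
      |∫ z, ψ z * w z| ≤ C * M * dualNorm w := by
  obtain ⟨c, hc0, χ, hχ⟩ := exists_cutoff d
  refine ⟨1 + c, by positivity, fun w hm h0 ψ M hM hψ hψM hψ0 => ?_⟩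
  have hgrow : ∀ x, |ψ x| ≤ M * ‖x‖ := fun x => by
    simpa [hψ0] using norm_sub_zero_le_of_fderiv hψ hψM x
  have htest : ∀ n, IsTest (fun x => ψ x * χ n x) ((1 + c) * M) := fun n => by
    obtain ⟨h1, h2, h3, h4, h5⟩ := hχ n
    refine ⟨hψ.mul h1, h2.mul_left, fun x => ?_⟩
    rw [fderiv_fun_mul (hψ.differentiable one_ne_zero x) (h1.differentiable one_ne_zero x)]
    refine (norm_add_le _ _).trans ?_
    rw [norm_smul, norm_smul, Real.norm_eq_abs, Real.norm_eq_abs]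
    have e1 : |ψ x| * ‖fderiv ℝ (χ n) x‖ ≤ M * c := by
      refine (mul_le_mul_of_nonneg_right (hgrow x) (norm_nonneg _)).trans ?_
      rw [mul_assoc]
      exact mul_le_mul_of_nonneg_left (h4 x) hM.le
    have e2 : |χ n x| * ‖fderiv ℝ ψ x‖ ≤ 1 * M :=
      mul_le_mul (h3 x) (hψM x) (norm_nonneg _) zero_le_one
    linarith
  have hlim : Tendsto (fun n => ∫ z, ψ z * χ n z * w z) atTop (𝓝 (∫ z, ψ z * w z)) := by
    refine tendsto_integral_of_dominated_convergence (fun z => ‖ψ z * w z‖) (fun n => ?_)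
      (integrable_mul_of_growth hm hψ.continuous hgrow).norm (fun n => ?_) ?_
    · exact ((hψ.continuous.mul (hχ n).1.continuous).aestronglyMeasurable).mul
        (L1.integrable_coeFn w).1
    · refine Eventually.of_forall fun z => ?_
      rw [mul_right_comm, norm_mul]
      exact mul_le_of_le_one_right (norm_nonneg _) ((hχ n).2.2.1 z)
    · refine Eventually.of_forall fun z => tendsto_const_nhds.congr' ?_
      obtain ⟨N, hN⟩ := exists_nat_ge ‖z‖
      filter_upwards [eventually_ge_atTop N] with n hn
      rw [(hχ n).2.2.2.2 z (hN.trans (by exact_mod_cast hn)), mul_one]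
  exact le_of_tendsto hlim.abs (Eventually.of_forall fun n =>
    (htest n).abs_integral_le (by positivity) hm h0)

end DualNorm

/-! ### The mean velocity is controlled by the dual norm -/

section MeanVelocity

variable {d : ℕ} {K : Phase d → Phase d → Phase d} {L : ℝ}
  {g h : Lp ℝ 1 (volume : Measure (Phase d))}

theorem IsInteractionKernel.integrable_smul (hK : IsInteractionKernel K L)
    (hg : HasFiniteFirstMoment g) (z : Phase d) : Integrable fun z' => g z' • K z z' := by
  have hi := L1.integrable_coeFn g
  refine Integrable.mono' ((hi.norm.const_mul (L * ‖z‖)).add (hg.norm.const_mul L))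
    (hi.1.smul (hK.contDiff_right z).continuous.aestronglyMeasurable)
    (Eventually.of_forall fun z' => ?_)
  have := mul_le_mul_of_nonneg_left (hK.norm_le z z') (norm_nonneg (g z'))
  rw [norm_smul]
  refine this.trans_eq ?_
  simp only [Pi.add_apply, norm_mul, norm_norm]
  ring

theorem IsInteractionKernel.continuous_meanVelocity (hK : IsInteractionKernel K L)
    (hg : HasFiniteFirstMoment g) : Continuous (meanVelocity K g) := by
  refine (LipschitzWith.of_dist_le_mul (K := (L * ‖g‖).toNNReal) fun x y => ?_).continuous
  rw [Real.coe_toNNReal _ (mul_nonneg hK.nonneg (norm_nonneg _)), dist_eq_norm, dist_eq_norm,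
    meanVelocity, meanVelocity, ← integral_sub (hK.integrable_smul hg x) (hK.integrable_smul hg y)]
  refine (norm_integral_le_of_norm_le (g := fun z' => L * ‖x - y‖ * ‖g z'‖)
    ((L1.integrable_coeFn g).norm.const_mul _) (Eventually.of_forall fun z' => ?_)).trans_eq ?_
  · rw [← smul_sub, norm_smul, mul_comm]
    exact mul_le_mul_of_nonneg_right (hK.norm_sub_le_left _ _ _) (norm_nonneg _)
  · rw [integral_const_mul, ← L1.norm_eq_integral_norm]; ring

theorem HasFiniteFirstMoment.sub (hg : HasFiniteFirstMoment g) (hh : HasFiniteFirstMoment h) :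
    HasFiniteFirstMoment (g - h : Lp ℝ 1 (volume : Measure (Phase d))) := by
  refine (Integrable.sub hg hh).congr ?_
  filter_upwards [Lp.coeFn_sub g h] with z hz
  rw [hz, Pi.sub_apply, Pi.sub_apply, mul_sub]

theorem IsInteractionKernel.meanVelocity_sub (hK : IsInteractionKernel K L)
    (hg : HasFiniteFirstMoment g) (hh : HasFiniteFirstMoment h) (z : Phase d) :
    meanVelocity K g z - meanVelocity K h z =
      meanVelocity K (g - h : Lp ℝ 1 (volume : Measure (Phase d))) z := by
  rw [meanVelocity, meanVelocity, meanVelocity,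
    ← integral_sub (hK.integrable_smul hg z) (hK.integrable_smul hh z)]
  refine integral_congr_ae ?_
  filter_upwards [Lp.coeFn_sub g h] with z hz
  rw [hz, Pi.sub_apply, sub_smul]

/-- Pair the velocity `v` at `z` with itself: `‖v‖²` is the integral against `w` of the Lipschitz
function `⟨v, K(z,x) - K(z,0)⟩`, zero mass making the subtraction harmless. The bound is uniform in
`z`. -/
theorem exists_norm_meanVelocity_le (hK : IsInteractionKernel K L) : ∃ C : ℝ, 0 ≤ C ∧
    ∀ w : Lp ℝ 1 (volume : Measure (Phase d)), HasFiniteFirstMoment w → ∫ z, w z = 0 →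
      ∀ z, ‖meanVelocity K w z‖ ≤ C * dualNorm w := by
  obtain ⟨C, hC0, hC⟩ := exists_abs_integral_le_dualNorm d
  have hL := hK.nonneg
  refine ⟨C * (L + 1), by positivity, fun w hm h0 z => ?_⟩
  set v := meanVelocity K w z with hv
  rcases eq_or_ne v 0 with hv0 | hv0
  · rw [hv0, norm_zero]; exact mul_nonneg (by positivity) (dualNorm_nonneg w)
  have hvpos : 0 < ‖v‖ := norm_pos_iff.2 hv0
  have hψd : ∀ x, HasFDerivAt (fun x => inner ℝ v (K z x - K z 0))
      ((innerSL ℝ v).comp (fderiv ℝ (fun x => K z x) x)) x := fun x =>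
    (innerSL ℝ v).hasFDerivAt.comp x
      (((hK.contDiff_right z).differentiable one_ne_zero x).hasFDerivAt.sub_const _)
  -- `L + 1` instead of `L` keeps the Lipschitz constant positive.
  have key := hC w hm h0 (fun x => inner ℝ v (K z x - K z 0)) (‖v‖ * (L + 1)) (by positivity)
    (contDiff_const.inner ℝ ((hK.contDiff_right z).sub contDiff_const)) (fun x => by
      rw [(hψd x).fderiv]
      refine (ContinuousLinearMap.opNorm_comp_le _ _).trans ?_
      rw [innerSL_apply_norm]
      have := hK.bound_right z x
      gcongr
      linarith) (by simp)
  have hi := hK.integrable_smul hm z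
  have e : ∫ x, inner ℝ v (K z x - K z 0) * w x = ‖v‖ ^ 2 := by
    have h1 : ∀ x, inner ℝ v (K z x - K z 0) * w x =
        inner ℝ v (w x • K z x) - inner ℝ v (K z 0) * w x := fun x => by
      rw [inner_sub_right, inner_smul_right]; ring
    simp_rw [h1]
    rw [integral_sub (hi.const_inner v) ((L1.integrable_coeFn w).const_mul _), integral_inner hi,
      integral_const_mul, h0, mul_zero, sub_zero]
    exact real_inner_self_eq_norm_sq v
  rw [e, abs_of_nonneg (by positivity)] at key
  have : ‖v‖ * ‖v‖ ≤ ‖v‖ * (C * (L + 1) * dualNorm w) := by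
    calc _ = ‖v‖ ^ 2 := by ring
      _ ≤ _ := key
      _ = _ := by ring
  exact le_of_mul_le_mul_left this hvpos

end MeanVelocity

/-! ### Uniqueness of weak solutions by duality -/

section Uniqueness

variable {d : ℕ} {K : Phase d → Phase d → Phase d} {L : ℝ} {ρ : Phase d → ℝ}
  {f g : ℝ → Lp ℝ 1 (volume : Measure (Phase d))}

theorem IsWeakSolution.integral_eq (hg : IsWeakSolution K ρ g) (t : ℝ) :
    ∫ z, g t z = ∫ z, ρ z := by
  have h1 : IsC1b fun _ : Phase d => (1 : ℝ) := ⟨contDiff_const, ⟨1, by simp⟩, 0, by simp⟩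
  have h2 : ∀ s, HasDerivAt (fun s => ∫ z, g s z) 0 s := fun s => by
    simpa using hg.weak_eq _ h1 s
  rw [is_const_of_deriv_eq_zero (fun s => (h2 s).differentiableAt) (fun s => (h2 s).deriv) t 0]
  exact integral_congr_ae hg.init

theorem IsWeakSolution.integral_sub_eq_zero (hg : IsWeakSolution K ρ g)
    (hf : IsWeakSolution K ρ f) (t : ℝ) :
    ∫ z, (g t - f t : Lp ℝ 1 (volume : Measure (Phase d))) z = 0 := by
  rw [integral_congr_ae (Lp.coeFn_sub (g t) (f t)), integral_sub' (L1.integrable_coeFn _)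
    (L1.integrable_coeFn _), hg.integral_eq, hf.integral_eq, sub_self]

variable {A : ℝ → Phase d → Phase d →L[ℝ] Phase d} {Λ : NNReal} {V Z Y : ℝ → Phase d → Phase d}

/-- The function `φ` at time `t`, transported backwards to time `r` by the flow `Z`. -/
def transportedTest (Z Y : ℝ → Phase d → Phase d) (φ : Phase d → ℝ) (t r : ℝ) (x : Phase d) : ℝ :=
  φ (Z t (Y r x))

variable {φ : Phase d → ℝ} {M : ℝ}

theorem contDiff_transportedTest (hY : IsInverseFlow Z Y) (hZ : IsFlow V Z)
    (hV : IsC1Field V A Λ) (hφ : ContDiff ℝ 1 φ) (t : ℝ) :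
    ContDiff ℝ 1 fun p : ℝ × Phase d => transportedTest Z Y φ t p.1 p.2 :=
  hφ.comp ((hZ.contDiff hV).comp (f := fun p : ℝ × Phase d => (t, Y p.1 p.2))
    (contDiff_const.prodMk (hY.contDiff hZ hV)))

/-- The map from time `r` to time `t` is factored through time `0`; each factor contributes one
exponential. -/
theorem isTest_transportedTest (hY : IsInverseFlow Z Y) (hZ : IsFlow V Z)
    (hV : IsC1Field V A Λ) (hφ : IsTest φ 1) (t r : ℝ) :
    IsTest (transportedTest Z Y φ t r) (Real.exp (Λ * |t|) * Real.exp (Λ * |r|)) where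
  contDiff := (contDiff_transportedTest hY hZ hV hφ.contDiff t).comp
    (f := fun x => (r, x)) (by fun_prop)
  compact := by
    have hc : ∀ {X : ℝ → Phase d → Phase d}, (Continuous fun p : ℝ × Phase d => X p.1 p.2) →
        ∀ s, Continuous (X s) := fun h s => h.comp (f := fun x => (s, x)) (by fun_prop)
    refine HasCompactSupport.intro (K := Z r '' (Y t '' tsupport φ))
      ((hφ.compact.isCompact.image (hc (hY.continuous hZ hV) t)).image
        (hc (hZ.continuous hV) r)) fun x hx => ?_
    by_contra hne
    exact hx ⟨Y r x, ⟨Z t (Y r x), subset_tsupport _ hne, hY.left_inv _ _⟩, hY.right_inv _ _⟩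
  bound x := by
    refine norm_fderiv_le_of_lip' ℝ (by positivity) (Eventually.of_forall fun y => ?_)
    have h1 := Convex.norm_image_sub_le_of_norm_fderiv_le (s := Set.univ)
      (fun z _ => hφ.contDiff.differentiable one_ne_zero z) (fun z _ => hφ.bound z) convex_univ
      (Set.mem_univ (Z t (Y r x))) (Set.mem_univ (Z t (Y r y)))
    rw [one_mul] at h1
    refine h1.trans ((hZ.norm_sub_le hV _ _ _).trans ?_)
    rw [mul_assoc]
    exact mul_le_mul_of_nonneg_left (hY.norm_sub_le hZ hV _ _ _) (Real.exp_pos _).le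

/-- The transported function is constant along trajectories, so its space-time derivative along `(1,
V)` vanishes. -/
theorem fderiv_transportedTest_apply (hY : IsInverseFlow Z Y) (hZ : IsFlow V Z)
    (hV : IsC1Field V A Λ) (hφ : ContDiff ℝ 1 φ) (t r : ℝ) (x : Phase d) :
    fderiv ℝ (fun p : ℝ × Phase d => transportedTest Z Y φ t p.1 p.2) (r, x) (1, 0) =
      -fderiv ℝ (transportedTest Z Y φ t r) x (V r x) := by
  have hθ := (contDiff_transportedTest hY hZ hV hφ t).differentiable one_ne_zero (r, x)
  have h1 : fderiv ℝ (fun p : ℝ × Phase d => transportedTest Z Y φ t p.1 p.2) (r, x)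
      (1, V r x) = 0 := by
    have hψ : ContDiff ℝ 1 fun y => φ (Z t y) :=
      hφ.comp ((hZ.contDiff hV).comp (f := fun y => (t, y)) (by fun_prop))
    have h2 := HasFDerivAt.comp (g := fun y => φ (Z t y)) (f := fun p : ℝ × Phase d => Y p.1 p.2)
      (r, x) (hψ.differentiable one_ne_zero _).hasFDerivAt
      ((hY.contDiff hZ hV).differentiable one_ne_zero (r, x)).hasFDerivAt
    have h3 := h2.fderiv
    change fderiv ℝ (fun p : ℝ × Phase d => transportedTest Z Y φ t p.1 p.2) (r, x) = _ at h3
    rw [h3, ContinuousLinearMap.comp_apply, hY.fderiv_apply hZ hV, map_zero]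
  have h4 : fderiv ℝ (transportedTest Z Y φ t r) x (V r x) =
      fderiv ℝ (fun p : ℝ × Phase d => transportedTest Z Y φ t p.1 p.2) (r, x) (0, V r x) := by
    have := (HasFDerivAt.comp (g := fun p : ℝ × Phase d => transportedTest Z Y φ t p.1 p.2)
      (f := fun x => (r, x)) x hθ.hasFDerivAt (hasFDerivAt_prodMk_right r x)).fderiv
    change fderiv ℝ (transportedTest Z Y φ t r) x = _ at this
    rw [this]
    simp
  rw [h4, eq_neg_iff_add_eq_zero, ← map_add, Prod.mk_add_mk, add_zero, zero_add, h1]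

/-- The time derivative of the test function removes the drift `V`, leaving only the velocity
mismatch; for `f`, whose velocity is `V`, the pairing is constant. -/
theorem IsWeakSolution.hasDerivAt_transportedTest (hK : IsInteractionKernel K L)
    (hg : IsWeakSolution K ρ g) (hY : IsInverseFlow Z Y) (hZ : IsFlow V Z)
    (hV : IsC1Field V A Λ) (hφ : IsTest φ 1) (t r : ℝ) :
    HasDerivAt (fun r => ∫ z, transportedTest Z Y φ t r z * g r z)
      (∫ z, fderiv ℝ (transportedTest Z Y φ t r) z (meanVelocity K (g r) z - V r z) * g r z) r := by
  have hθ := isTest_transportedTest hY hZ hV hφ t r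
  have hc : ∀ {X : ℝ → Phase d → Phase d}, (Continuous fun p : ℝ × Phase d => X p.1 p.2) →
      ∀ s, Continuous (X s) := fun h s => h.comp (f := fun x => (s, x)) (by fun_prop)
  have hkc : IsCompact ((fun p : ℝ × Phase d => Z p.1 p.2) ''
      (Set.Icc (r - 1) (r + 1) ×ˢ (Y t '' tsupport φ))) :=
    (isCompact_Icc.prod (hφ.compact.isCompact.image (hc (hY.continuous hZ hV) t))).image
      (hZ.continuous hV)
  have key := hasDerivAt_integral_mul_curve (θ := transportedTest Z Y φ t)
    (contDiff_transportedTest hY hZ hV hφ.contDiff t) hkc (r₀ := r) (fun s hs x hx => by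
      by_contra hne
      exact hx ⟨(s, Y s x), ⟨hs, Z t (Y s x), subset_tsupport _ hne, hY.left_inv _ _⟩,
        hY.right_inv _ _⟩) hg.continuous (hg.weak_eq _ hθ.isC1b r)
  convert key using 1
  have hint : ∀ {v : Phase d → Phase d}, Continuous v →
      Integrable fun z => fderiv ℝ (transportedTest Z Y φ t r) z (v z) * g r z := by
    intro v hv
    have h1 : Continuous fun z => fderiv ℝ (transportedTest Z Y φ t r) z (v z) :=
      (hθ.contDiff.continuous_fderiv one_ne_zero).clm_apply hv
    have h2 : HasCompactSupport fun z => fderiv ℝ (transportedTest Z Y φ t r) z (v z) :=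
      (hθ.compact.fderiv ℝ).mono fun z hz => by
        contrapose! hz
        simp [Function.notMem_support.1 hz]
    obtain ⟨B, hB⟩ := h2.exists_bound_of_continuous h1
    exact integrable_mul_L1 h1 hB _
  simp_rw [fderiv_transportedTest_apply hY hZ hV hφ.contDiff, neg_mul, map_sub, sub_mul]
  rw [integral_sub (hint (hK.continuous_meanVelocity (hg.moment r)))
    (hint (hc hV.continuous r)), integral_neg]
  ring

/-- Pair `g - f` with the transported test function between `s` and `t`. At time `t` this is the
pairing with `φ`, at time `s` it costs the Lipschitz factor `E`, and in between its derivative is at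
most `E C |G|` times the bound on the dual norm. -/
theorem IsWeakSolution.exists_isSelfImproving (hK : IsInteractionKernel K L)
    (hf : IsWeakSolution K ρ f) (hg : IsWeakSolution K ρ g)
    (hY : IsInverseFlow Z Y) (hZ : IsFlow V Z) (hV : IsC1Field V A Λ)
    (hVf : ∀ t z, V t z = meanVelocity K (f t) z) (T : ℝ) :
    ∃ E M, IsSelfImproving (fun t => dualNorm (g t - f t)) E M T := by
  obtain ⟨C, hC0, hC⟩ := exists_norm_meanVelocity_le hK
  obtain ⟨G, hG⟩ := (isCompact_Icc (a := -T) (b := T)).exists_bound_of_continuousOn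
    hg.continuous.continuousOn
  set E := Real.exp (Λ * T) * Real.exp (Λ * T) with hE
  have hE0 : 0 < E := by positivity
  have hm := fun t => (hg.moment t).sub (hf.moment t)
  have h0 := fun t => hg.integral_sub_eq_zero hf t
  have hdiff : ∀ {φ : Phase d → ℝ} {M : ℝ}, IsTest φ M → ∀ t,
      ∫ z, φ z * (g t - f t : Lp ℝ 1 (volume : Measure (Phase d))) z =
        (∫ z, φ z * g t z) - ∫ z, φ z * f t z := fun h t => by
    obtain ⟨B, hB⟩ := h.bounded
    exact integral_mul_L1_sub h.contDiff.continuous hB _ _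
  refine ⟨E, E * C * |G|, fun t => dualNorm_nonneg _, fun c => ?_, ?_, hE0.le, by positivity⟩
  -- Lower semicontinuity: the dual norm is a supremum of pairings, each continuous in time by the
  -- weak equation.
  · have : {t | dualNorm (g t - f t) ≤ c} = ⋂ φ : {φ : Phase d → ℝ // IsTest φ 1},
        {t | |(∫ z, φ.1 z * g t z) - ∫ z, φ.1 z * f t z| ≤ c} := by
      ext t
      simp only [Set.mem_ofPred_eq, Set.mem_iInter]
      rw [dualNorm, ciSup_le_iff (bddAbove_dualNorm (hm t) (h0 t))]
      exact forall_congr' fun φ => by rw [hdiff φ.2]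
    rw [this]
    refine isClosed_iInter fun φ => isClosed_le (Continuous.abs (Continuous.sub ?_ ?_))
      continuous_const
    · exact continuous_iff_continuousAt.2 fun t => (hg.weak_eq _ φ.2.isC1b t).continuousAt
    · exact continuous_iff_continuousAt.2 fun t => (hf.weak_eq _ φ.2.isC1b t).continuousAt
  · intro s hs t ht c hc
    refine ciSup_le fun ⟨φ, hφ⟩ => ?_
    have hexp : ∀ r ∈ Set.Icc (-T) T, Real.exp (Λ * |r|) ≤ Real.exp (Λ * T) := fun r hr => by
      have := abs_le.2 hr
      gcongr
    have hθ : ∀ r ∈ Set.Icc (-T) T, IsTest (transportedTest Z Y φ t r) E := fun r hr => by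
      have h := isTest_transportedTest hY hZ hV hφ t r
      exact ⟨h.contDiff, h.compact, fun x => (h.bound x).trans
        (mul_le_mul (hexp t ht) (hexp r hr) (Real.exp_pos _).le (Real.exp_pos _).le)⟩
    have hd : ∀ r, HasDerivAt (fun r => (∫ z, transportedTest Z Y φ t r z * g r z) -
        ∫ z, transportedTest Z Y φ t r z * f r z)
        (∫ z, fderiv ℝ (transportedTest Z Y φ t r) z
          (meanVelocity K (g r) z - meanVelocity K (f r) z) * g r z) r := fun r => by
      have h := (hg.hasDerivAt_transportedTest hK hY hZ hV hφ t r).fun_sub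
        (hf.hasDerivAt_transportedTest hK hY hZ hV hφ t r)
      simpa [hVf] using h
    have hsub : Set.uIcc s t ⊆ Set.Icc (-T) T := Set.uIcc_subset_Icc hs ht
    have hc0 : 0 ≤ c := (dualNorm_nonneg _).trans (hc s Set.left_mem_uIcc)
    have hbd : ∀ r ∈ Set.uIcc s t, ‖∫ z, fderiv ℝ (transportedTest Z Y φ t r) z
          (meanVelocity K (g r) z - meanVelocity K (f r) z) * g r z‖ ≤ E * C * |G| * c := by
      intro r hr
      have h1 : ∀ z, |fderiv ℝ (transportedTest Z Y φ t r) z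
          (meanVelocity K (g r) z - meanVelocity K (f r) z)| ≤ E * (C * c) := fun z => by
        refine (ContinuousLinearMap.le_of_opNorm_le _ ((hθ r (hsub hr)).bound z) _).trans ?_
        rw [hK.meanVelocity_sub (hg.moment r) (hf.moment r)]
        have := hC _ (hm r) (h0 r) z
        have := mul_le_mul_of_nonneg_left (hc r hr) hC0
        gcongr
        linarith
      refine (abs_integral_mul_L1_le h1 (g r)).trans ?_
      have h2 := (hG r (hsub hr)).trans (le_abs_self G)
      calc _ ≤ E * (C * c) * |G| := by gcongr
        _ = _ := by ring
    have hmv := (convex_uIcc s t).norm_image_sub_le_of_norm_hasDerivWithin_le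
      (fun r _ => (hd r).hasDerivWithinAt) hbd Set.left_mem_uIcc Set.right_mem_uIcc
    have ht' : ∀ z, transportedTest Z Y φ t t z = φ z := fun z => by
      rw [transportedTest, hY.right_inv]
    simp only [ht', ← hdiff hφ, ← hdiff (hθ s hs), Real.norm_eq_abs] at hmv
    have hs' := (hθ s hs).abs_integral_le hE0 (hm s) (h0 s)
    have := abs_sub_abs_le_abs_sub
      (∫ z, φ z * (g t - f t : Lp ℝ 1 (volume : Measure (Phase d))) z)
      (∫ z, transportedTest Z Y φ t s z * (g s - f s : Lp ℝ 1 (volume : Measure (Phase d))) z)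
    linarith

/-- The dual norm of the difference vanishes, so the difference annihilates all smooth compactly
supported functions and is zero a.e. -/
theorem IsWeakSolution.unique (hK : IsInteractionKernel K L)
    (hf : IsWeakSolution K ρ f) (hg : IsWeakSolution K ρ g)
    (hY : IsInverseFlow Z Y) (hZ : IsFlow V Z) (hV : IsC1Field V A Λ)
    (hVf : ∀ t z, V t z = meanVelocity K (f t) z) : g = f := by
  funext t
  obtain ⟨E, M, h⟩ := hf.exists_isSelfImproving hK hg hY hZ hV hVf |t|
  have h0 : g 0 - f 0 = 0 := sub_eq_zero.2 (Lp.ext (hg.init.trans hf.init.symm))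
  have hz : dualNorm (g t - f t) = 0 := h.eq_zero (by
    have : ∀ φ : Phase d → ℝ,
        ∫ z, φ z * (0 : Lp ℝ 1 (volume : Measure (Phase d))) z = 0 := fun φ => by simp
    simp only [h0, dualNorm, this, abs_zero, ciSup_const]) t (abs_le.1 le_rfl)
  set w := g t - f t with hw
  have hm : HasFiniteFirstMoment w := (hg.moment t).sub (hf.moment t)
  have hw0 := hg.integral_sub_eq_zero hf t
  have hae : ∀ᵐ z ∂(volume : Measure (Phase d)), w z = 0 := by
    refine ae_eq_zero_of_integral_contDiff_smul_eq_zero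
      (L1.integrable_coeFn w).locallyIntegrable fun ψ hψ hψc => ?_
    have hψ1 : ContDiff ℝ 1 ψ := hψ.of_le (by exact_mod_cast le_top)
    obtain ⟨B, hB⟩ := (hψc.fderiv ℝ).exists_bound_of_continuous
      (hψ1.continuous_fderiv one_ne_zero)
    have htest : IsTest ψ (|B| + 1) :=
      ⟨hψ1, hψc, fun x => (hB x).trans ((le_abs_self B).trans (by linarith))⟩
    have := htest.abs_integral_le (by positivity) hm hw0
    rw [hz, mul_zero] at this
    simpa using abs_nonpos_iff.1 this
  have h1 : w =ᵐ[volume] (0 : Phase d → ℝ) := hae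
  exact sub_eq_zero.1 (Lp.ext (h1.trans (Lp.coeFn_zero _ _ _).symm))

end Uniqueness

end MeanField

end

theorem mainTheorem2 {d : ℕ}
    (K : MeanField.Phase d → MeanField.Phase d → MeanField.Phase d) (L : ℝ)
    (hK : MeanField.IsInteractionKernel K L)
    (fin : MeanField.Phase d → ℝ)
    (hfin : MeanField.IsProbDensity fin)
    (hmom : MeanField.HasFiniteFirstMoment fin) :
    -- the particle system is globally well posed
    (∀ N : ℕ, 1 ≤ N → ∀ z : Fin N → MeanField.Phase d,
      ∃! Z : ℝ → Fin N → MeanField.Phase d, MeanField.IsParticleSolution K z Z) ∧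
    -- existence, uniqueness and mean field limit for the mean field equation
    ∃ f : ℝ → Lp ℝ 1 (volume : Measure (MeanField.Phase d)),
      MeanField.IsWeakSolution K fin f ∧
      (∀ g : ℝ → Lp ℝ 1 (volume : Measure (MeanField.Phase d)),
        MeanField.IsWeakSolution K fin g → g = f) ∧
      (∀ t : ℝ, MeanField.IsProbDensity (f t)) ∧
      ∀ z : (N : ℕ) → Fin N → MeanField.Phase d,
        Tendsto (fun N => MeanField.distMK (MeanField.empirical (z N))
          (MeanField.densityMeasure fin)) atTop (𝓝 0) →
        ∀ Z : (N : ℕ) → ℝ → Fin N → MeanField.Phase d,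
          (∀ N : ℕ, 1 ≤ N → MeanField.IsParticleSolution K (z N) (Z N)) →
          ∀ t : ℝ,
            MeanField.WeaklyConverges (fun N => MeanField.empirical (Z N t))
              (MeanField.densityMeasure (f t)) ∧
            (∀ N : ℕ, 1 ≤ N →
              MeanField.distMK (MeanField.empirical (Z N t)) (MeanField.densityMeasure (f t)) ≤
                ENNReal.ofReal (Real.exp (2 * L * |t|)) *
                  MeanField.distMK (MeanField.empirical (z N))
                    (MeanField.densityMeasure fin)) ∧
            Tendsto (fun N => MeanField.distMK (MeanField.empirical (Z N t))
              (MeanField.densityMeasure (f t))) atTop (𝓝 0) := by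
  have := hfin.isProbabilityMeasure
  have hμ := hmom.integrable_id hfin
  obtain ⟨u, hu⟩ := MeanField.exists_isCharacteristicFlow hK hμ
  obtain ⟨Y, hY⟩ := hu.isFlow.exists_inverse hu.isC1Field
  refine ⟨fun N hN z => ?_, MeanField.densityCurve hu hY hfin,
    MeanField.isWeakSolution_densityCurve, fun g hg => ?_,
    fun t => MeanField.isProbDensity_densityCurve t, fun z hz Z hZ t => ?_⟩
  · have := MeanField.isProbabilityMeasure_empirical hN z
    obtain ⟨v, hv⟩ := MeanField.exists_isCharacteristicFlow hK
      (MeanField.integrable_id_empirical hN z)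
    exact ⟨_, hv.isParticleSolution, fun W hW => hW.unique hK hv.isParticleSolution⟩
  · exact MeanField.isWeakSolution_densityCurve.unique hK hg hY hu.isFlow hu.isC1Field
      fun t z => (MeanField.meanVelocity_densityCurve t z).symm
  · have hest : ∀ N : ℕ, 1 ≤ N →
        MeanField.distMK (MeanField.empirical (Z N t))
          (MeanField.densityMeasure (MeanField.densityCurve hu hY hfin t)) ≤
        ENNReal.ofReal (Real.exp (2 * L * |t|)) *
          MeanField.distMK (MeanField.empirical (z N)) (MeanField.densityMeasure fin) := by
      intro N hN
      have := MeanField.isProbabilityMeasure_empirical hN (z N)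
      obtain ⟨v, hv⟩ := MeanField.exists_isCharacteristicFlow hK
        (MeanField.integrable_id_empirical hN (z N))
      -- By uniqueness the given particles are the characteristic flow of their empirical measure,
      -- so both measures at time `t` are images of the initial ones under characteristic flows.
      rw [(hZ N hN).unique hK hv.isParticleSolution, MeanField.densityMeasure_densityCurve,
        ← MeanField.map_empirical (MeanField.continuous_unweight (v t)).measurable]
      exact MeanField.distMK_map_le hv hu t
    have hlim : Tendsto (fun N => MeanField.distMK (MeanField.empirical (Z N t))
        (MeanField.densityMeasure (MeanField.densityCurve hu hY hfin t))) atTop (𝓝 0) := by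
      have h0 : Tendsto (fun N => ENNReal.ofReal (Real.exp (2 * L * |t|)) *
          MeanField.distMK (MeanField.empirical (z N)) (MeanField.densityMeasure fin))
          atTop (𝓝 0) := by
        simpa using ENNReal.Tendsto.const_mul hz (Or.inr ENNReal.ofReal_ne_top)
      exact tendsto_of_tendsto_of_tendsto_of_le_of_le' tendsto_const_nhds h0
        (Eventually.of_forall fun _ => zero_le) ((eventually_ge_atTop 1).mono hest)
    refine ⟨fun φ => ?_, hest, hlim⟩
    have := (MeanField.isProbDensity_densityCurve (hu := hu) (hY := hY) (hρ := hfin)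
      t).isProbabilityMeasure
    -- The index is shifted because the empirical measure of zero particles is the zero measure, not
    -- a probability measure.
    exact (tendsto_add_atTop_iff_nat 1).1 (MeanField.tendsto_integral_of_tendsto_distMK
      (fun N => MeanField.isProbabilityMeasure_empirical (by omega) (Z (N + 1) t))
      ((tendsto_add_atTop_iff_nat 1).2 hlim) φ)
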